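/- **Notation.** Every infinite series over $n\ge 1$ is understood as the limit of its partial sums (many of them converge only conditionally); a nested series over $0<n_1<\cdots<n_r$ is summed with the largest variable $n_r$ outermost, i.e. it is the limit as $N\to\infty$ of the finite sums over $0<n_1<\cdots<n_r\le N$. Let $$\bar\zeta(k)=\sum_{n=1}^\infty\frac{(-1)^{n-1}}{n^k}\quad(k\ge 1),\qquad \bar\zeta(0)=\tfrac12 .$$ For positive integers $k_1,\dots,k_r$ let $$\overline{T}(k_1,\dots,k_r)=2^r\sum_{0<n_1<\cdots<n_r}\frac{(-1)^{n_r}}{(2n_1-1)^{k_1}(2n_2-2)^{k_2}\cdots(2n_r-r)^{k_r}},$$ and let $$W(w,r)=\sum_{\substack{k_1+\cdots+k_r=w\\ k_1,\dots,k_r\ge 1}}\overline{T}(k_1,\dots,k_r).$$ Let $\{1\}_r$ be the sequence of $r$ ones, let $T_n(\{1\}_0)=S_n(\{1\}_0)=1$, and for $r\ge1$ put $$T_n(\{1\}_r)=\sum\frac{2^r}{(2n_1-1)(2n_2)(2n_3-1)(2n_4)\cdots}\quad(r\text{ factors}),$$ the sum being over positive integers $n_1\le n_2<n_3\le n_4<\cdots$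 ($r$ variables) with $n_r\le n$ if $r$ is odd and $n_r<n$ if $r$ is even, and $$S_n(\{1\}_r)=\sum\frac{2^r}{(2n_1)(2n_2-1)(2n_3)(2n_4-1)\cdots}\quad(r\text{ factors}),$$ the sum being over positive integers $n_1<n_2\le n_3<n_4\le\cdots$ ($r$ variables) with $n_r<n$ if $r$ is odd and $n_r\le n$ if $r$ is even (empty sums are $0$). **Theorem.** Let $m$ and $p$ be positive integers. Then all the series occurring below (including those defining the values $\bar\zeta$ and $\overline{T}$) converge, and $$W(2p+2m-1,2m)=2(-1)^m\sum_{j=0}^{p-1}\bar\zeta(2p-2-2j)\sum_{n=1}^\infty\frac{T_n(\{1\}_{2m-1})T_n(\{1\}_{2j+1})}{n}(-1)^n,$$ $$\begin{aligned}W(2p+2m-2,2m)={}&2(-1)^m\sum_{j=0}^{p-2}\bar\zeta(2p-3-2j)\sum_{n=1}^\infty\frac{T_n(\{1\}_{2m-1})T_n(\{1\}_{2j+1})}{n}(-1)^n\\&+(-1)^m\sum_{n=1}^\infty\frac{T_n(\{1\}_{2m-1})S_n(\{1\}_{2p-2})}{n}(-1)^n,\end{aligned}$$ $$\begin{aligned}W(2p+2m-2,2m-1)={}&4(-1)^{m-1}\sum_{j=0}^{p-1}\bar\zeta(2p-1-2j)\sum_{n=1}^\infty\frac{T_n(\{1\}_{2m-2})T_n(\{1\}_{2j})}{2n-1}(-1)^n\\&+2(-1)^{m-1}\sum_{n=1}^\infty\frac{T_n(\{1\}_{2m-2})S_n(\{1\}_{2p-1})}{2n-1}(-1)^n,\end{aligned}$$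 $$W(2p+2m-3,2m-1)=4(-1)^{m-1}\sum_{j=0}^{p-1}\bar\zeta(2p-2-2j)\sum_{n=1}^\infty\frac{T_n(\{1\}_{2m-2})T_n(\{1\}_{2j})}{2n-1}(-1)^n .$$ -/

import Mathlib

open Filter Topology

noncomputable section

namespace AltMTV

/-! Many of the series below converge only conditionally, so every infinite series
`∑_{n ≥ 1} a n` is the limit of its partial sums `∑_{n = 1}^{N} a n`. -/

/-- The series `∑_{n ≥ 1} a n` converges. -/
def SeriesConverges (a : ℕ → ℝ) : Prop :=
  ∃ s : ℝ, Tendsto (fun N : ℕ => ∑ n ∈ Finset.Icc 1 N, a n) atTop (𝓝 s)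

/-- The value of the series `∑_{n ≥ 1} a n`, the limit of its partial sums
(meaningful when `SeriesConverges a`). -/
def series (a : ℕ → ℝ) : ℝ :=
  limUnder atTop (fun N : ℕ => ∑ n ∈ Finset.Icc 1 N, a n)

/-- The general term `(-1)^(n-1) / n^s` of the alternating zeta series. -/
def zetaBarTerm (s n : ℕ) : ℝ := (-1) ^ (n - 1) / (n : ℝ) ^ s

/-- The alternating Riemann zeta value, with the convention that its value at `0` is `1/2`. -/
def zetaBar (s : ℕ) : ℝ := if s = 0 then 1 / 2 else series (zetaBarTerm s)

/-- `I(w, r)`: the indices `(k_1, …, k_r)` of positive integers of weight `w` and depth `r`. -/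
def indexSet (w r : ℕ) : Finset (Fin r → ℕ) :=
  (Finset.Nat.antidiagonalTuple r w).filter (fun k => ∀ i, 0 < k i)

/-- The index `(1, …, 1)` of depth `r`. -/
def ones (r : ℕ) : Fin r → ℕ := fun _ => 1

/-- The finite nested sum
`2^r ∑_{0 < n_1 < ⋯ < n_r ≤ N} 1 / ((2 n_1 - 1)^{k_1} (2 n_2 - 2)^{k_2} ⋯ (2 n_r - r)^{k_r})`,
written by summing over the largest summation variable last. -/
def truncT : (r : ℕ) → (Fin r → ℕ) → ℕ → ℝ
  | 0, _, _ => 1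
  | r + 1, k, N => ∑ n ∈ Finset.Icc 1 N,
      2 * truncT r (Fin.init k) (n - 1) / (2 * (n : ℝ) - ((r + 1 : ℕ) : ℝ)) ^ k (Fin.last r)

/-- The general term, indexed by the largest summation variable `n = n_r`, of the series
`2^r ∑_{0 < n_1 < ⋯ < n_r} (-1)^{n_r} / ((2 n_1 - 1)^{k_1} ⋯ (2 n_r - r)^{k_r})`.
(The value for the empty index plays no role.) -/
def altTTerm : (r : ℕ) → (Fin r → ℕ) → ℕ → ℝ
  | 0, _, _ => 0
  | r + 1, k, n =>
      2 * (-1) ^ n * truncT r (Fin.init k) (n - 1) /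
        (2 * (n : ℝ) - ((r + 1 : ℕ) : ℝ)) ^ k (Fin.last r)

/-- The alternating multiple `T`-value whose last argument alone is barred:
`2^r ∑_{0 < n_1 < ⋯ < n_r} (-1)^{n_r} / ((2 n_1 - 1)^{k_1} ⋯ (2 n_r - r)^{k_r})`. -/
def altT (r : ℕ) (k : Fin r → ℕ) : ℝ := series (altTTerm r k)

/-- `W(w, r)`, the sum of the alternating multiple `T`-values over all indices of weight `w` and
depth `r`. -/
def W (w r : ℕ) : ℝ := ∑ k ∈ indexSet w r, altT r k

/-- The multiple `T`-harmonic sum `T_n(k_1, …, k_r)`: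
`2^r` times the sum of `1 / ((2 n_1 - 1)^{k_1} (2 n_2)^{k_2} (2 n_3 - 1)^{k_3} (2 n_4)^{k_4} ⋯)`
over `0 < n_1 ≤ n_2 < n_3 ≤ n_4 < ⋯` (`r` variables), with `n_r ≤ n` if `r` is odd and `n_r < n`
if `r` is even; it is `1` for the empty index. The recursion splits off the last variable `l`. -/
def tSum : (r : ℕ) → (Fin r → ℕ) → ℕ → ℝ
  | 0, _, _ => 1
  | r + 1, k, n =>
      if Odd (r + 1) then
        ∑ l ∈ Finset.Icc 1 n, 2 * tSum r (Fin.init k) l / (2 * (l : ℝ) - 1) ^ k (Fin.last r)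
      else
        ∑ l ∈ Finset.Ico 1 n, 2 * tSum r (Fin.init k) l / (2 * (l : ℝ)) ^ k (Fin.last r)

/-- The multiple `S`-harmonic sum `S_n(k_1, …, k_r)`:
`2^r` times the sum of `1 / ((2 n_1)^{k_1} (2 n_2 - 1)^{k_2} (2 n_3)^{k_3} (2 n_4 - 1)^{k_4} ⋯)`
over `0 < n_1 < n_2 ≤ n_3 < n_4 ≤ ⋯` (`r` variables), with `n_r < n` if `r` is odd and `n_r ≤ n`
if `r` is even; it is `1` for the empty index. The recursion splits off the last variable `l`. -/
def sSum : (r : ℕ) → (Fin r → ℕ) → ℕ → ℝ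
  | 0, _, _ => 1
  | r + 1, k, n =>
      if Odd (r + 1) then
        ∑ l ∈ Finset.Ico 1 n, 2 * sSum r (Fin.init k) l / (2 * (l : ℝ)) ^ k (Fin.last r)
      else
        ∑ l ∈ Finset.Icc 1 n, 2 * sSum r (Fin.init k) l / (2 * (l : ℝ) - 1) ^ k (Fin.last r)

/-- The term `T_n({1}_a) T_n({1}_b) / n · (-1)^n`. -/
def termTTEven (a b n : ℕ) : ℝ := tSum a (ones a) n * tSum b (ones b) n / (n : ℝ) * (-1) ^ n

/-- The term `T_n({1}_a) S_n({1}_b) / n · (-1)^n`. -/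
def termTSEven (a b n : ℕ) : ℝ := tSum a (ones a) n * sSum b (ones b) n / (n : ℝ) * (-1) ^ n

/-- The term `T_n({1}_a) T_n({1}_b) / (2n-1) · (-1)^n`. -/
def termTTOdd (a b n : ℕ) : ℝ :=
  tSum a (ones a) n * tSum b (ones b) n / (2 * (n : ℝ) - 1) * (-1) ^ n

/-- The term `T_n({1}_a) S_n({1}_b) / (2n-1) · (-1)^n`. -/
def termTSOdd (a b n : ℕ) : ℝ :=
  tSum a (ones a) n * sSum b (ones b) n / (2 * (n : ℝ) - 1) * (-1) ^ n

end AltMTV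

end

open AltMTV

/-! Sorting by weight, the moments `∫₀¹ g(t) (-log t)^q / q! dt` of a function form a power series
in a variable `X` on which integration by parts acts by simple rules. Summing a multiple `T`-value
one variable at a time against the moments of `t^N (π/2 - 2 arctan t)^d / d!` telescopes, since
`(1 + t²) · 2 / (1 + t²) = 2`, and identifies `W(w, r + 1)` up to sign with a moment of
`(π/2 - 2 arctan t)^r / r! · 2 / (1 + t²)`.

The Cayley involution `c(t) = (1 - t) / (1 + t)` satisfies `2 arctan c(t) = π/2 - 2 arctan t`, so
this function is the Taylor series of `(2 arctan u)^r / r! · 2 / (1 + u²)` at `u = c(t)` times the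
Jacobian of `c`. The Taylor coefficients and the moments of the powers of `c` obey two-step
recurrences that differ only by a sign. Unrolling them produces `T_n({1}_j)` and `S_n({1}_j)`, and
the initial moment, that of the Jacobian, contributes the alternating zeta values. -/

noncomputable section

namespace AltMTV

section Series

/-- The series `∑_{n ≥ 1} a n` converges to `s`, in the sense of its partial sums. -/
def HasSeries (a : ℕ → ℝ) (s : ℝ) : Prop :=
  Tendsto (fun N : ℕ => ∑ n ∈ Finset.Icc 1 N, a n) atTop (𝓝 s)

variable {a b : ℕ → ℝ} {s t : ℝ}

lemma HasSeries.seriesConverges (h : HasSeries a s) : SeriesConverges a := ⟨s, h⟩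

lemma HasSeries.series_eq (h : HasSeries a s) : series a = s := h.limUnder_eq

lemma SeriesConverges.hasSeries (h : SeriesConverges a) : HasSeries a (series a) := by
  obtain ⟨s, hs⟩ := h
  exact (HasSeries.series_eq hs).symm ▸ hs

lemma HasSeries.unique (hs : HasSeries a s) (ht : HasSeries a t) : s = t :=
  tendsto_nhds_unique hs ht

lemma HasSeries.congr (h : ∀ n, 1 ≤ n → a n = b n) (ha : HasSeries a s) : HasSeries b s :=
  Tendsto.congr (fun _ => Finset.sum_congr rfl fun n hn => h n (Finset.mem_Icc.1 hn).1) ha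

lemma HasSeries.const_mul (c : ℝ) (ha : HasSeries a s) : HasSeries (fun n => c * a n) (c * s) :=
  (Tendsto.const_mul c ha).congr fun _ => Finset.mul_sum ..

lemma HasSeries.add (ha : HasSeries a s) (hb : HasSeries b t) :
    HasSeries (fun n => a n + b n) (s + t) :=
  (Tendsto.add ha hb).congr fun _ => Finset.sum_add_distrib.symm

lemma HasSeries.sum {ι : Type*} {S : Finset ι} {a : ι → ℕ → ℝ} {s : ι → ℝ}
    (h : ∀ i ∈ S, HasSeries (a i) (s i)) :
    HasSeries (fun n => ∑ i ∈ S, a i n) (∑ i ∈ S, s i) :=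
  (tendsto_finsetSum S h).congr fun _ => Finset.sum_comm

lemma sum_Icc_one (a : ℕ → ℝ) (n : ℕ) :
    ∑ l ∈ Finset.Icc 1 n, a l = ∑ l ∈ Finset.range n, a (l + 1) := by
  simp_rw [← Finset.Ico_add_one_right_eq_Icc, Finset.sum_Ico_eq_sum_range, Nat.add_sub_cancel,
    add_comm 1]

lemma sum_Icc_one_of_eq_zero {r : ℕ} (ha : ∀ n, 1 ≤ n → n ≤ r → a n = 0) (E : ℕ) :
    ∑ n ∈ Finset.Icc 1 (r + E), a n = ∑ e ∈ Finset.range E, a (r + 1 + e) := by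
  rw [sum_Icc_one, Finset.sum_range_add, Finset.sum_eq_zero fun k hk =>
    ha (k + 1) (by omega) (Finset.mem_range.1 hk), zero_add]
  exact Finset.sum_congr rfl fun e _ => by rw [add_right_comm]

lemma hasSeries_iff_range :
    HasSeries a s ↔ Tendsto (fun N => ∑ k ∈ Finset.range N, a (k + 1)) atTop (𝓝 s) := by
  simp_rw [HasSeries, sum_Icc_one]

lemma hasSeries_of_shift {r : ℕ} (ha : ∀ n, 1 ≤ n → n ≤ r → a n = 0)
    (h : Tendsto (fun E => ∑ e ∈ Finset.range E, a (r + 1 + e)) atTop (𝓝 s)) :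
    HasSeries a s :=
  (tendsto_add_atTop_iff_nat r).1 (h.congr fun E => by
    rw [add_comm E, sum_Icc_one_of_eq_zero ha])

lemma sum_range_two_mul {M : Type*} [AddCommMonoid M] (f : ℕ → M) (n : ℕ) :
    ∑ k ∈ Finset.range (2 * n), f k = ∑ k ∈ Finset.range n, (f (2 * k) + f (2 * k + 1)) := by
  induction n with
  | zero => rfl
  | succ n ih =>
    rw [mul_add_one, Finset.sum_range_succ, Finset.sum_range_succ, ih, Finset.sum_range_succ,
      add_assoc]

lemma HasSeries.even (ha : ∀ k, Odd k → a k = 0) (h : HasSeries a s) :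
    HasSeries (fun n => a (2 * n)) s := by
  refine hasSeries_iff_range.2 (((hasSeries_iff_range.1 h).comp
    (tendsto_id.const_mul_atTop' two_pos)).congr fun N => ?_)
  exact (sum_range_two_mul _ N).trans
    (Finset.sum_congr rfl fun k _ => by rw [ha _ ⟨k, rfl⟩, zero_add]; rfl)

lemma HasSeries.odd (ha : ∀ k, Even k → a k = 0) (h : HasSeries a s) :
    HasSeries (fun n => a (2 * n - 1)) s := by
  refine hasSeries_iff_range.2 (((hasSeries_iff_range.1 h).comp
    (tendsto_id.const_mul_atTop' two_pos)).congr fun N => ?_)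
  exact (sum_range_two_mul _ N).trans
    (Finset.sum_congr rfl fun k _ => by rw [ha (2 * k + 1 + 1) ⟨k + 1, by ring⟩, add_zero]; rfl)

end Series

section Growth

open Asymptotics

/-- The sequence `a` has order at most `c`: it is `O(n^s)` for every `s > c`. This notion of order
ignores logarithmic factors, so that summing a sequence of order `-1` gives one of order `0`. -/
def GrowthLE (c : ℝ) (a : ℕ → ℝ) : Prop := ∀ s, c < s → a =O[atTop] fun n : ℕ => (n : ℝ) ^ s

variable {a b : ℕ → ℝ} {c d : ℝ}

lemma GrowthLE.mono (hcd : c ≤ d) (ha : GrowthLE c a) : GrowthLE d a :=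
  fun s hs => ha s (hcd.trans_lt hs)

lemma GrowthLE.of_abs_le (h : ∀ n, |a n| ≤ |b n|) (hb : GrowthLE c b) : GrowthLE c a :=
  fun s hs => (IsBigO.of_norm_le h).trans (hb s hs).norm_left

lemma GrowthLE.add (ha : GrowthLE c a) (hb : GrowthLE c b) :
    GrowthLE c fun n => a n + b n :=
  fun s hs => (ha s hs).add (hb s hs)

lemma GrowthLE.sum {ι : Type*} {S : Finset ι} {a : ι → ℕ → ℝ} (h : ∀ i ∈ S, GrowthLE c (a i)) :
    GrowthLE c fun n => ∑ i ∈ S, a i n :=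
  fun s hs => IsBigO.fun_sum fun i hi => h i hi s hs

lemma GrowthLE.mul (ha : GrowthLE c a) (hb : GrowthLE d b) :
    GrowthLE (c + d) fun n => a n * b n := by
  intro s hs
  refine ((ha (c + (s - (c + d)) / 2) (by linarith)).mul
    (hb (d + (s - (c + d)) / 2) (by linarith))).congr' .rfl ?_
  filter_upwards [eventually_gt_atTop 0] with n hn
  rw [← Real.rpow_add (Nat.cast_pos.2 hn)]
  ring_nf

lemma growthLE_const (x : ℝ) : GrowthLE 0 fun _ => x := by
  intro s hs
  refine IsBigO.of_bound |x| ?_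
  filter_upwards [eventually_ge_atTop 1] with n hn
  have : (1 : ℝ) ≤ (n : ℝ) ^ s := Real.one_le_rpow (Nat.one_le_cast.2 hn) hs.le
  rw [Real.norm_eq_abs, Real.norm_of_nonneg (by positivity)]
  exact le_mul_of_one_le_right (abs_nonneg x) this

lemma GrowthLE.const_mul (x : ℝ) (ha : GrowthLE c a) : GrowthLE c fun n => x * a n := by
  simpa only [zero_add] using (growthLE_const x).mul ha

lemma GrowthLE.alternating (ha : GrowthLE c a) : GrowthLE c fun n => (-1) ^ n * a n :=
  ha.of_abs_le fun n => by rw [abs_mul, abs_neg_one_pow, one_mul]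

lemma isTheta_natCast_succ_rpow (s : ℝ) :
    (fun n : ℕ => ((n + 1 : ℕ) : ℝ) ^ s) =Θ[atTop] fun n : ℕ => (n : ℝ) ^ s := by
  refine IsTheta.rpow (.of_forall fun n => Nat.cast_nonneg _)
    (.of_forall fun n => Nat.cast_nonneg _) ⟨IsBigO.of_bound 2 ?_, IsBigO.of_bound 1 ?_⟩
  · filter_upwards [eventually_ge_atTop 1] with n hn
    rw [Real.norm_natCast, Real.norm_natCast]
    exact_mod_cast (by omega : n + 1 ≤ 2 * n)
  · refine .of_forall fun n => ?_
    rw [Real.norm_natCast, Real.norm_natCast, one_mul]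
    exact_mod_cast n.le_succ

lemma GrowthLE.shift (ha : GrowthLE c a) : GrowthLE c fun n => a (n + 1) :=
  fun s hs => ((ha s hs).comp_tendsto (tendsto_add_atTop_nat 1)).trans
    (isTheta_natCast_succ_rpow s).isBigO

lemma growthLE_inv_linear {x : ℝ} (hx : 0 ≤ x) : GrowthLE (-1) fun n => (2 * n + x)⁻¹ := by
  intro s hs
  refine IsBigO.of_bound 1 ?_
  filter_upwards [eventually_ge_atTop 1] with n hn
  have hn' : (1 : ℝ) ≤ n := Nat.one_le_cast.2 hn
  rw [Real.norm_of_nonneg (by positivity), Real.norm_of_nonneg (by positivity), one_mul]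
  calc (2 * n + x)⁻¹ ≤ (n : ℝ)⁻¹ := inv_anti₀ (by linarith) (by linarith)
    _ = (n : ℝ) ^ (-1 : ℝ) := (Real.rpow_neg_one _).symm
    _ ≤ (n : ℝ) ^ s := Real.rpow_le_rpow_of_exponent_le hn' hs.le

lemma GrowthLE.tendsto_zero (hc : c < 0) (ha : GrowthLE c a) : Tendsto a atTop (𝓝 0) := by
  refine (ha (c / 2) (by linarith)).trans_tendsto ?_
  simpa only [Function.comp_def, neg_neg] using
    (tendsto_rpow_neg_atTop (show 0 < -(c / 2) by linarith)).comp tendsto_natCast_atTop_atTop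

lemma GrowthLE.summable (hc : c < -1) (ha : GrowthLE c a) : Summable a :=
  summable_of_isBigO_nat (Real.summable_nat_rpow.2 (show (c - 1) / 2 < -1 by linarith))
    (ha _ (by linarith))

lemma GrowthLE.sum_range (ha : GrowthLE (-1) a) :
    GrowthLE 0 fun n => ∑ l ∈ Finset.range n, a l := by
  intro s hs
  have hsum : Summable fun l => |a l| * ((l + 1 : ℕ) : ℝ) ^ (-s) := by
    refine summable_of_isBigO_nat (Real.summable_nat_rpow.2 (show -1 - s / 2 < -1 by linarith))
      (((ha (-1 + s / 2) (by linarith)).norm_left.mul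
        (isTheta_natCast_succ_rpow (-s)).isBigO).congr' .rfl ?_)
    filter_upwards [eventually_gt_atTop 0] with n hn
    rw [← Real.rpow_add (Nat.cast_pos.2 hn)]
    ring_nf
  refine IsBigO.of_bound (∑' l, |a l| * ((l + 1 : ℕ) : ℝ) ^ (-s)) (.of_forall fun n => ?_)
  rw [Real.norm_eq_abs, Real.norm_of_nonneg (by positivity)]
  calc |∑ l ∈ Finset.range n, a l|
      ≤ ∑ l ∈ Finset.range n, |a l| := Finset.abs_sum_le_sum_abs _ _
    _ ≤ ∑ l ∈ Finset.range n, |a l| * ((l + 1 : ℕ) : ℝ) ^ (-s) * (n : ℝ) ^ s := by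
        refine Finset.sum_le_sum fun l hl => ?_
        have hle : ((l + 1 : ℕ) : ℝ) ^ s ≤ (n : ℝ) ^ s :=
          Real.rpow_le_rpow (by positivity) (by exact_mod_cast Finset.mem_range.1 hl) hs.le
        rw [mul_assoc, Real.rpow_neg (by positivity)]
        refine le_mul_of_one_le_right (abs_nonneg _) ?_
        rwa [inv_mul_eq_div, one_le_div (by positivity)]
    _ ≤ _ := by
        rw [← Finset.sum_mul]
        gcongr
        exact hsum.sum_le_tsum _ fun l _ => by positivity

lemma growthLE_of_two_step (hb : GrowthLE (-1) b) (h : ∀ n, |a (n + 2)| ≤ |a n| + |b n|) :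
    GrowthLE 0 a := by
  have hbound : ∀ n, |a n| ≤ |a 0| + |a 1| + ∑ l ∈ Finset.range n, |b l| := by
    intro n
    induction n using Nat.twoStepInduction with
    | zero => simp
    | one => linarith [abs_nonneg (a 0), Finset.sum_nonneg fun l (_ : l ∈ Finset.range 1) =>
        abs_nonneg (b l)]
    | more n ih _ =>
      rw [Finset.sum_range_succ, Finset.sum_range_succ]
      linarith [h n, abs_nonneg (b (n + 1))]
  have habs : GrowthLE (-1) fun l => |b l| := hb.of_abs_le fun l => (abs_abs _).le
  exact ((growthLE_const (|a 0| + |a 1|)).add habs.sum_range).of_abs_le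
    fun n => (hbound n).trans (le_abs_self _)

end Growth

section Symbols

/-- The sequence `a` is a discrete symbol of order `c`: it has order at most `c`, and taking
differences lowers the order by one. -/
def IsSymbol (c : ℝ) (a : ℕ → ℝ) : Prop :=
  GrowthLE c a ∧ GrowthLE (c - 1) fun n => a (n + 1) - a n

variable {a b : ℕ → ℝ} {c d : ℝ}

lemma isSymbol_const (x : ℝ) : IsSymbol 0 fun _ => x :=
  ⟨growthLE_const x, fun s _ => by
    simpa only [sub_self] using Asymptotics.isBigO_zero (fun n : ℕ => (n : ℝ) ^ s) atTop⟩

lemma IsSymbol.mono (hcd : c ≤ d) (ha : IsSymbol c a) : IsSymbol d a :=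
  ⟨ha.1.mono hcd, ha.2.mono (by linarith)⟩

lemma IsSymbol.shift (ha : IsSymbol c a) : IsSymbol c fun n => a (n + 1) :=
  ⟨ha.1.shift, ha.2.shift⟩

lemma IsSymbol.mul (ha : IsSymbol c a) (hb : IsSymbol d b) :
    IsSymbol (c + d) fun n => a n * b n := by
  refine ⟨ha.1.mul hb.1, ?_⟩
  have h := ((ha.1.shift.mul hb.2).mono (show c + (d - 1) ≤ c + d - 1 by linarith)).add
    ((ha.2.mul hb.1).mono (show c - 1 + d ≤ c + d - 1 by linarith))
  convert h using 2 with n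
  ring

lemma IsSymbol.const_mul (x : ℝ) (ha : IsSymbol c a) : IsSymbol c fun n => x * a n := by
  simpa only [zero_add] using (isSymbol_const x).mul ha

lemma isSymbol_inv_linear {x : ℝ} (hx : 0 < x) : IsSymbol (-1) fun n => (2 * n + x)⁻¹ := by
  refine ⟨growthLE_inv_linear hx.le, ?_⟩
  have h := ((growthLE_inv_linear hx.le).shift.mul (growthLE_inv_linear hx.le)).const_mul (-2)
  convert h using 2 with n
  · norm_num
  · push_cast
    field

lemma isSymbol_inv_linear_pow {x : ℝ} (hx : 0 < x) {k : ℕ} (hk : 0 < k) :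
    IsSymbol (-1) fun n => (2 * n + x)⁻¹ ^ k := by
  induction k, hk using Nat.le_induction with
  | base => simpa only [pow_one] using isSymbol_inv_linear hx
  | succ k _ ih => exact (ih.mul (isSymbol_inv_linear hx)).mono (by norm_num)

lemma IsSymbol.sum_range (ha : IsSymbol (-1) a) :
    IsSymbol 0 fun n => ∑ l ∈ Finset.range n, a l :=
  ⟨ha.1.sum_range, by simpa only [Finset.sum_range_succ_sub_sum, zero_sub] using ha.1⟩

lemma two_mul_sum_alternating (a : ℕ → ℝ) (n : ℕ) :
    2 * ∑ e ∈ Finset.range n, (-1) ^ e * a e =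
      a 0 - (-1) ^ n * a n - ∑ e ∈ Finset.range n, (-1) ^ e * (a (e + 1) - a e) := by
  induction n with
  | zero => simp
  | succ n ih =>
    rw [Finset.sum_range_succ, mul_add, ih, Finset.sum_range_succ]
    ring

lemma IsSymbol.exists_tendsto_alternating (hc : c < 0) (ha : IsSymbol c a) :
    ∃ s, Tendsto (fun n => ∑ e ∈ Finset.range n, (-1) ^ e * a e) atTop (𝓝 s) := by
  have hboundary : Tendsto (fun n => (-1) ^ n * a n) atTop (𝓝 0) :=
    ha.1.alternating.tendsto_zero hc
  have hdiff : Summable fun e => (-1) ^ e * (a (e + 1) - a e) :=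
    ha.2.alternating.summable (by linarith)
  refine ⟨_, (((hboundary.const_sub (a 0)).sub hdiff.hasSum.tendsto_sum_nat).const_mul
    (1 / 2)).congr fun n => ?_⟩
  rw [← two_mul_sum_alternating]
  ring

lemma IsSymbol.seriesConverges {f : ℕ → ℝ} (hc : c < 0) (hf : IsSymbol c f) (r : ℕ)
    (hzero : ∀ n, 1 ≤ n → n ≤ r → a n = 0) (hterm : ∀ e, a (r + 1 + e) = (-1) ^ e * f e) :
    SeriesConverges a := by
  obtain ⟨s, hs⟩ := hf.exists_tendsto_alternating hc
  exact ⟨s, hasSeries_of_shift hzero (by simpa only [hterm] using hs)⟩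

end Symbols

section Convergence

lemma truncT_eq_zero {r : ℕ} (k : Fin r → ℕ) {n : ℕ} (hn : n < r) : truncT r k n = 0 := by
  induction r generalizing n with
  | zero => exact absurd hn n.not_lt_zero
  | succ r ih =>
    refine Finset.sum_eq_zero fun l hl => ?_
    rw [ih _ (by grind), mul_zero, zero_div]

lemma truncT_succ_add (r : ℕ) (k : Fin (r + 1) → ℕ) (e : ℕ) :
    truncT (r + 1) k (r + 1 + e) = ∑ l ∈ Finset.range (e + 1),
      2 * truncT r (Fin.init k) (r + l) * (2 * l + (r + 1 : ℕ) : ℝ)⁻¹ ^ k (Fin.last r) := by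
  have hzero : ∀ n, 1 ≤ n → n ≤ r → 2 * truncT r (Fin.init k) (n - 1) /
      (2 * (n : ℝ) - ((r + 1 : ℕ) : ℝ)) ^ k (Fin.last r) = 0 := fun n _ _ => by
    rw [truncT_eq_zero _ (by omega), mul_zero, zero_div]
  rw [truncT, show r + 1 + e = r + (e + 1) by ring, sum_Icc_one_of_eq_zero hzero]
  refine Finset.sum_congr rfl fun l _ => ?_
  rw [show r + 1 + l - 1 = r + l by omega, inv_pow, ← div_eq_mul_inv]
  congr 2
  push_cast
  ring

lemma altTTerm_eq_zero {r : ℕ} (k : Fin (r + 1) → ℕ) {n : ℕ} (hn : 1 ≤ n) (hr : n ≤ r) :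
    altTTerm (r + 1) k n = 0 := by
  rw [altTTerm, truncT_eq_zero _ (by omega), mul_zero, zero_div]

lemma altTTerm_succ_add (r : ℕ) (k : Fin (r + 1) → ℕ) (e : ℕ) :
    altTTerm (r + 1) k (r + 1 + e) = (-1) ^ e * ((-1) ^ (r + 1) *
      (2 * truncT r (Fin.init k) (r + e) * (2 * e + (r + 1 : ℕ) : ℝ)⁻¹ ^ k (Fin.last r))) := by
  rw [altTTerm, show r + 1 + e - 1 = r + e by omega, inv_pow, pow_add,
    show 2 * ((r + 1 + e : ℕ) : ℝ) - (r + 1 : ℕ) = 2 * e + (r + 1 : ℕ) by push_cast; ring]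
  ring

lemma isSymbol_truncT {r : ℕ} {k : Fin r → ℕ} (hk : ∀ i, 0 < k i) :
    IsSymbol 0 fun e => truncT r k (r + e) := by
  induction r with
  | zero => exact isSymbol_const 1
  | succ r ih =>
    have hterm := ((ih (k := Fin.init k) fun i => hk _).const_mul 2).mul
      (isSymbol_inv_linear_pow (x := (r + 1 : ℕ)) (by positivity) (hk (Fin.last r)))
    simp_rw [truncT_succ_add]
    exact (hterm.mono (by norm_num)).sum_range.shift

lemma altTTerm_converges {r : ℕ} {k : Fin (r + 1) → ℕ} (hk : ∀ i, 0 < k i) :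
    SeriesConverges (altTTerm (r + 1) k) := by
  have hterm := ((((isSymbol_truncT (k := Fin.init k) fun i => hk _).const_mul 2).mul
    (isSymbol_inv_linear_pow (x := (r + 1 : ℕ)) (by positivity) (hk (Fin.last r)))).const_mul
      ((-1) ^ (r + 1)))
  exact hterm.seriesConverges (by norm_num) r (fun n => altTTerm_eq_zero k) (altTTerm_succ_add r k)

lemma init_ones (r : ℕ) : Fin.init (ones (r + 1)) = ones r := rfl

lemma tSum_ones_odd (j n : ℕ) : tSum (2 * j + 1) (ones _) n =
    ∑ l ∈ Finset.range n, 2 * tSum (2 * j) (ones _) (l + 1) * (2 * l + 1 : ℝ)⁻¹ := by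
  rw [tSum, if_pos (odd_two_mul_add_one j), sum_Icc_one]
  refine Finset.sum_congr rfl fun l _ => ?_
  rw [init_ones, ones, pow_one, div_eq_mul_inv, Nat.cast_add_one]
  ring_nf

lemma tSum_ones_even (j n : ℕ) : tSum (2 * j + 2) (ones _) (n + 1) =
    ∑ l ∈ Finset.range n, 2 * tSum (2 * j + 1) (ones _) (l + 1) * (2 * l + 2 : ℝ)⁻¹ := by
  rw [tSum, if_neg (by grind), Finset.Ico_add_one_right_eq_Icc, sum_Icc_one]
  refine Finset.sum_congr rfl fun l _ => ?_
  rw [init_ones, ones, pow_one, div_eq_mul_inv, Nat.cast_add_one]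
  ring_nf

lemma sSum_ones_odd (j n : ℕ) : sSum (2 * j + 1) (ones _) (n + 1) =
    ∑ l ∈ Finset.range n, 2 * sSum (2 * j) (ones _) (l + 1) * (2 * l + 2 : ℝ)⁻¹ := by
  rw [sSum, if_pos (odd_two_mul_add_one j), Finset.Ico_add_one_right_eq_Icc, sum_Icc_one]
  refine Finset.sum_congr rfl fun l _ => ?_
  rw [init_ones, ones, pow_one, div_eq_mul_inv, Nat.cast_add_one]
  ring_nf

lemma sSum_ones_even (j n : ℕ) : sSum (2 * j + 2) (ones _) n =
    ∑ l ∈ Finset.range n, 2 * sSum (2 * j + 1) (ones _) (l + 1) * (2 * l + 1 : ℝ)⁻¹ := by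
  rw [sSum, if_neg (by grind), sum_Icc_one]
  refine Finset.sum_congr rfl fun l _ => ?_
  rw [init_ones, ones, pow_one, div_eq_mul_inv, Nat.cast_add_one]
  ring_nf

lemma isSymbol_two_mul_mul_inv_linear {a : ℕ → ℝ} (ha : IsSymbol 0 a) {x : ℝ} (hx : 0 < x) :
    IsSymbol (-1) fun l => 2 * a l * (2 * l + x)⁻¹ :=
  ((ha.const_mul 2).mul (isSymbol_inv_linear hx)).mono (by norm_num)

lemma isSymbol_tSum_ones (r : ℕ) : IsSymbol 0 fun n => tSum r (ones r) (n + 1) := by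
  induction r with
  | zero => exact isSymbol_const 1
  | succ r ih =>
    rcases Nat.even_or_odd' r with ⟨j, rfl | rfl⟩
    · simp_rw [tSum_ones_odd]
      exact (isSymbol_two_mul_mul_inv_linear ih one_pos).sum_range.shift
    · simp_rw [tSum_ones_even]
      exact (isSymbol_two_mul_mul_inv_linear ih two_pos).sum_range

lemma isSymbol_sSum_ones (r : ℕ) : IsSymbol 0 fun n => sSum r (ones r) (n + 1) := by
  induction r with
  | zero => exact isSymbol_const 1
  | succ r ih =>
    rcases Nat.even_or_odd' r with ⟨j, rfl | rfl⟩
    · simp_rw [sSum_ones_odd]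
      exact (isSymbol_two_mul_mul_inv_linear ih two_pos).sum_range
    · simp_rw [sSum_ones_even]
      exact (isSymbol_two_mul_mul_inv_linear ih one_pos).sum_range.shift

lemma seriesConverges_div_alternating {a : ℕ → ℝ} (ha : IsSymbol 0 fun n => a (n + 1)) :
    SeriesConverges fun n => a n / n * (-1) ^ n := by
  have h := (isSymbol_two_mul_mul_inv_linear ha two_pos).const_mul (-1)
  refine h.seriesConverges (by norm_num) 0 (by omega) fun e => ?_
  rw [zero_add, add_comm 1 e, Nat.cast_add_one, pow_succ]
  field

lemma seriesConverges_div_odd_alternating {a : ℕ → ℝ} (ha : IsSymbol 0 fun n => a (n + 1)) :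
    SeriesConverges fun n => a n / (2 * n - 1) * (-1) ^ n := by
  have h := (isSymbol_two_mul_mul_inv_linear ha one_pos).const_mul (-1 / 2)
  refine h.seriesConverges (by norm_num) 0 (by omega) fun e => ?_
  rw [zero_add, add_comm 1 e, Nat.cast_add_one, pow_succ,
    show 2 * ((e : ℝ) + 1) - 1 = 2 * e + 1 by ring]
  field

lemma termTTEven_converges (a b : ℕ) : SeriesConverges (termTTEven a b) :=
  seriesConverges_div_alternating
    (by simpa only [add_zero] using (isSymbol_tSum_ones a).mul (isSymbol_tSum_ones b))

lemma termTSEven_converges (a b : ℕ) : SeriesConverges (termTSEven a b) :=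
  seriesConverges_div_alternating
    (by simpa only [add_zero] using (isSymbol_tSum_ones a).mul (isSymbol_sSum_ones b))

lemma termTTOdd_converges (a b : ℕ) : SeriesConverges (termTTOdd a b) :=
  seriesConverges_div_odd_alternating
    (by simpa only [add_zero] using (isSymbol_tSum_ones a).mul (isSymbol_tSum_ones b))

lemma termTSOdd_converges (a b : ℕ) : SeriesConverges (termTSOdd a b) :=
  seriesConverges_div_odd_alternating
    (by simpa only [add_zero] using (isSymbol_tSum_ones a).mul (isSymbol_sSum_ones b))

end Convergence

section Moments

open MeasureTheory unitInterval PowerSeries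

/-- The function `f` on the unit interval is differentiable with derivative `f'`, one-sided at the
endpoints. -/
def HasDerivI (f f' : C(I, ℝ)) : Prop :=
  ∀ x : I, HasDerivWithinAt (Set.IccExtend zero_le_one f) (f' x) I x

/-- The coordinate function on the unit interval. -/
def coord : C(I, ℝ) := ⟨Subtype.val, continuous_subtype_val⟩

variable {f f' g g' h h' : C(I, ℝ)}

lemma hasDerivI_of_hasDerivAt (F : ℝ → ℝ) (hf : ∀ x : I, f x = F x)
    (hF : ∀ x : I, HasDerivAt F (f' x) x) : HasDerivI f f' := fun x =>
  (hF x).hasDerivWithinAt.congr (fun y hy => by rw [Set.IccExtend_of_mem _ _ hy, hf])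
    (by rw [Set.IccExtend_val, hf])

lemma hasDerivI_coord : HasDerivI coord 1 :=
  hasDerivI_of_hasDerivAt id (fun _ => rfl) fun _ => hasDerivAt_id _

lemma hasDerivI_coord_pow (n : ℕ) : HasDerivI (coord ^ n) ((n : ℝ) • coord ^ (n - 1)) :=
  hasDerivI_of_hasDerivAt (· ^ n) (fun _ => rfl) fun x => hasDerivAt_pow n (x : ℝ)

lemma hasDerivI_const (x : ℝ) : HasDerivI (.const I x) 0 :=
  hasDerivI_of_hasDerivAt (fun _ => x) (fun _ => rfl) fun _ => hasDerivAt_const _ _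

lemma HasDerivI.add (hf : HasDerivI f f') (hg : HasDerivI g g') : HasDerivI (f + g) (f' + g') :=
  fun x => (hf x).add (hg x)

lemma HasDerivI.sub (hf : HasDerivI f f') (hg : HasDerivI g g') : HasDerivI (f - g) (f' - g') :=
  fun x => (hf x).sub (hg x)

lemma HasDerivI.smul (c : ℝ) (hf : HasDerivI f f') : HasDerivI (c • f) (c • f') :=
  fun x => (hf x).const_smul c

lemma HasDerivI.sum {ι : Type*} {S : Finset ι} {f f' : ι → C(I, ℝ)}
    (hf : ∀ i ∈ S, HasDerivI (f i) (f' i)) : HasDerivI (∑ i ∈ S, f i) (∑ i ∈ S, f' i) := by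
  classical
  induction S using Finset.induction_on with
  | empty => exact hasDerivI_const 0
  | insert i S hi ih =>
    rw [Finset.sum_insert hi, Finset.sum_insert hi]
    exact (hf i (Finset.mem_insert_self i S)).add
      (ih fun j hj => hf j (Finset.mem_insert_of_mem hj))

lemma HasDerivI.mul (hf : HasDerivI f f') (hg : HasDerivI g g') :
    HasDerivI (f * g) (f' * g + f * g') := fun x => by
  simpa only [Set.IccExtend_val] using! (hf x).mul (hg x)

lemma HasDerivI.comp {φ : C(I, I)} {φ' : C(I, ℝ)} (hf : HasDerivI f f')
    (hφ : HasDerivI (coord.comp φ) φ') : HasDerivI (f.comp φ) (f'.comp φ * φ') := by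
  intro x
  have hval : Set.IccExtend zero_le_one (coord.comp φ) x = φ x := Set.IccExtend_val _ _ _
  have hcomp := HasDerivWithinAt.comp (x : ℝ) (hval ▸ hf (φ x)) (hφ x)
    fun y _ => (φ (Set.projIcc 0 1 zero_le_one y)).2
  refine hcomp.congr_of_eventuallyEq (.of_forall fun y => ?_) ?_ <;>
  exact (Set.IccExtend_val zero_le_one f _).symm

lemma integral_deriv (hf : HasDerivI f f') : ∫ x : I, f' x = f 1 - f 0 := by
  have hcont : ∀ g : C(I, ℝ), Continuous (Set.IccExtend zero_le_one g) := fun g =>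
    g.continuous.Icc_extend'
  calc ∫ x : I, f' x = ∫ x : I, Set.IccExtend zero_le_one f' x := by
        simp_rw [Set.IccExtend_val]
    _ = ∫ x in (0 : ℝ)..1, Set.IccExtend zero_le_one f' x := by
        rw [integral_subtype measurableSet_Icc, integral_Icc_eq_integral_Ioc,
          intervalIntegral.integral_of_le zero_le_one]
    _ = Set.IccExtend zero_le_one f 1 - Set.IccExtend zero_le_one f 0 := by
        refine intervalIntegral.integral_eq_sub_of_hasDerivAt_of_le zero_le_one
          (hcont f).continuousOn (fun x hx => ?_) ((hcont f').intervalIntegrable 0 1)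
        have hx' : x ∈ I := Set.Ioo_subset_Icc_self hx
        rw [Set.IccExtend_of_mem _ _ hx']
        exact (hf ⟨x, hx'⟩).hasDerivAt (Icc_mem_nhds hx.1 hx.2)
    _ = f 1 - f 0 := by rw [Set.IccExtend_right, Set.IccExtend_left]; rfl

lemma integrable_continuousMap (f : C(I, ℝ)) : Integrable f :=
  f.continuous.integrable_of_hasCompactSupport (.of_compactSpace f)

/-- Scaling of the unit interval by `x`. -/
def scale (x : I) : C(I, I) := ⟨fun s => x * s, continuous_const.mul continuous_id⟩

/-- The averaging operator, `average g x = ∫₀¹ g(xs) ds = x⁻¹ ∫₀ˣ g`. It inverts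
`h ↦ h + t h'`, the derivative of `t h`. -/
def average : C(I, ℝ) →ₗ[ℝ] C(I, ℝ) where
  toFun g :=
    { toFun x := ∫ s : I, g (x * s)
      continuous_toFun := by
        simpa only [setIntegral_univ] using continuous_parametric_integral_of_continuous
          (μ := volume) (f := fun x s : I => g (x * s)) (by fun_prop) isCompact_univ }
  map_add' f g := ContinuousMap.ext fun x => integral_add
    (integrable_continuousMap (f.comp (scale x))) (integrable_continuousMap (g.comp (scale x)))
  map_smul' c g := ContinuousMap.ext fun x => integral_const_mul c fun s => g (x * s)

lemma hasDerivI_scale (x : I) : HasDerivI (coord.comp (scale x)) (.const I x) :=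
  hasDerivI_of_hasDerivAt (fun s => x * s) (fun _ => rfl) fun s => by
    simpa only [mul_one] using! (hasDerivAt_id (s : ℝ)).const_mul (x : ℝ)

lemma average_mono (hfg : f ≤ g) : average f ≤ average g := fun x =>
  integral_mono (integrable_continuousMap (f.comp (scale x)))
    (integrable_continuousMap (g.comp (scale x))) fun s => hfg (x * s)

lemma average_add_coord_mul (hh : HasDerivI h h') : average (h + coord * h') = h := by
  ext x
  calc ∫ s : I, (h (x * s) + x * s * h' (x * s))
      = ∫ s : I, (1 * h.comp (scale x) + coord * (h'.comp (scale x) * .const I x)) s :=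
        integral_congr_ae (.of_forall fun s => by
          change _ = 1 * h (x * s) + s * (h' (x * s) * x)
          ring)
    _ = h x := by
        rw [integral_deriv (hasDerivI_coord.mul (hh.comp (hasDerivI_scale x)))]
        change 1 * h (x * 1) - 0 * h (x * 0) = h x
        rw [mul_one, one_mul, zero_mul, sub_zero]

lemma coord_mul_average (hf : HasDerivI f f') (hzero : f 0 = 0) : coord * average f' = f := by
  ext x
  calc x * ∫ s : I, f' (x * s) = ∫ s : I, (f'.comp (scale x) * .const I x) s := by
        rw [← integral_const_mul]
        exact integral_congr_ae (.of_forall fun s => mul_comm _ _)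
    _ = f x := by
        rw [integral_deriv (hf.comp (hasDerivI_scale x))]
        change f (x * 1) - f (x * 0) = f x
        rw [mul_one, mul_zero, hzero, sub_zero]

lemma coord_pow_add_deriv (n : ℕ) :
    coord ^ n + coord * ((n : ℝ) • coord ^ (n - 1)) = (n + 1 : ℝ) • coord ^ n := by
  cases n with
  | zero => simp
  | succ n =>
    rw [Nat.add_sub_cancel, mul_smul_comm, ← pow_succ', add_comm, add_smul _ (1 : ℝ), one_smul]

lemma average_coord_pow (n : ℕ) : average (coord ^ n) = (n + 1 : ℝ)⁻¹ • coord ^ n := by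
  have h := average_add_coord_mul (hasDerivI_coord_pow n)
  rw [coord_pow_add_deriv, map_smul] at h
  rw [eq_inv_smul_iff₀ (by positivity), h]

lemma abs_le_of_abs_deriv_le (hf : HasDerivI f f') (hzero : f 0 = 0) {A B : ℝ} {n : ℕ}
    (hB : 0 ≤ B) (hbound : ∀ x : I, |f' x| ≤ A + B * x ^ n) (x : I) :
    |f x| ≤ A + B / (n + 1) := by
  have hpow : average (A • coord ^ 0 + B • coord ^ n) x = A + B / (n + 1) * x ^ n := by
    rw [map_add, map_smul, map_smul, average_coord_pow, average_coord_pow]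
    change A * ((((0 : ℕ) : ℝ) + 1)⁻¹ * x ^ 0) + B * ((n + 1 : ℝ)⁻¹ * x ^ n) = _
    rw [Nat.cast_zero]
    ring
  have hle : |average f' x| ≤ average (A • coord ^ 0 + B • coord ^ n) x := by
    rw [abs_le, ← ContinuousMap.neg_apply, ← map_neg]
    exact ⟨average_mono (g := f')
      (fun s => by simpa using! neg_le_of_abs_le (hbound s)) x,
      average_mono (fun s => by simpa using! le_of_abs_le (hbound s)) x⟩
  rw [← coord_mul_average hf hzero]
  calc |(x : ℝ) * average f' x| = x * |average f' x| := by rw [abs_mul, abs_of_nonneg x.2.1]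
    _ ≤ 1 * (A + B / (n + 1) * 1) := by
        rw [hpow] at hle
        refine mul_le_mul x.2.2 (hle.trans ?_) (abs_nonneg _) zero_le_one
        gcongr
        exact pow_le_one₀ x.2.1 x.2.2
    _ = A + B / (n + 1) := by ring

/-- The moments `∫₀¹ g(t) (-log t)^q / q! dt`, collected into the power series
`∫₀¹ g(t) t^(-X) dt`. The `q`-th one is the value at `1` of the `(q + 1)`-st iterated average
of `g`. -/
def moments : C(I, ℝ) →ₗ[ℝ] ℝ⟦X⟧ where
  toFun g := PowerSeries.mk fun q => (average ^ (q + 1)) g 1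
  map_add' f g := by
    ext q
    simp only [coeff_mk, map_add, ContinuousMap.add_apply]
  map_smul' c g := by
    ext q
    simp only [coeff_mk, map_smul, ContinuousMap.smul_apply, RingHom.id_apply]

lemma coeff_moments (q : ℕ) (g : C(I, ℝ)) :
    coeff q (moments g) = (average ^ (q + 1)) g 1 :=
  coeff_mk q fun q => (average ^ (q + 1)) g 1

lemma moments_add_coord_mul (hh : HasDerivI h h') :
    moments (h + coord * h') = X * moments h + C (h 1) := by
  ext q
  rw [coeff_moments, pow_succ, Module.End.mul_apply, average_add_coord_mul hh, map_add, coeff_C]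
  cases q with
  | zero => rw [coeff_zero_X_mul, if_pos rfl, zero_add, pow_zero, Module.End.one_apply]
  | succ q => rw [coeff_succ_X_mul, coeff_moments, if_neg q.succ_ne_zero, add_zero]

lemma coeff_moments_mono (hfg : f ≤ g) (q : ℕ) : coeff q (moments f) ≤ coeff q (moments g) := by
  have hpow : ∀ n, (average ^ n) f ≤ (average ^ n) g := fun n => by
    induction n with
    | zero => exact hfg
    | succ n ih =>
      rw [pow_succ']
      exact average_mono ih
  rw [coeff_moments, coeff_moments]
  exact hpow (q + 1) 1

lemma abs_coeff_moments_le (hfg : ∀ x, |f x| ≤ g x) (q : ℕ) :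
    |coeff q (moments f)| ≤ coeff q (moments g) := by
  rw [abs_le, ← map_neg, ← map_neg]
  exact ⟨coeff_moments_mono (fun x => neg_le_of_abs_le (hfg x)) q,
    coeff_moments_mono (fun x => le_of_abs_le (hfg x)) q⟩

/-- The power series `1 / (a - X)`, for `a ≠ 0`. -/
def geom (a : ℝ) : ℝ⟦X⟧ := PowerSeries.mk fun q => a⁻¹ ^ (q + 1)

lemma C_sub_X_mul_geom {a : ℝ} (ha : a ≠ 0) : (C a - X) * geom a = 1 := by
  ext q
  cases q with
  | zero => simp [geom, sub_mul, ha]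
  | succ q =>
    rw [sub_mul, map_sub, coeff_C_mul, coeff_succ_X_mul, geom, coeff_mk, coeff_mk, coeff_one,
      if_neg q.succ_ne_zero, pow_succ' _ (q + 1), mul_inv_cancel_left₀ ha, sub_self]

lemma moments_coord_pow (n : ℕ) : moments (coord ^ n) = geom (n + 1) := by
  have h := moments_add_coord_mul (hasDerivI_coord_pow n)
  have hne : (n + 1 : ℝ) ≠ 0 := by positivity
  have hone : (coord ^ n) 1 = 1 := one_pow n
  rw [coord_pow_add_deriv, map_smul, hone, map_one, ← sub_eq_iff_eq_add', smul_eq_C_mul,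
    ← sub_mul] at h
  exact left_inv_eq_right_inv ((mul_comm _ _).trans h) (C_sub_X_mul_geom hne)

lemma abs_coeff_moments_coord_pow_mul_le (n : ℕ) (f : C(I, ℝ)) (q : ℕ) :
    |coeff q (moments (coord ^ n * f))| ≤ ‖f‖ * (n + 1 : ℝ)⁻¹ ^ (q + 1) := by
  have hle := abs_coeff_moments_le (f := coord ^ n * f) (g := ‖f‖ • coord ^ n) (fun x => ?_) q
  · rwa [map_smul, moments_coord_pow, coeff_smul, geom, coeff_mk] at hle
  · change |(x : ℝ) ^ n * f x| ≤ ‖f‖ * (x : ℝ) ^ n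
    rw [abs_mul, abs_of_nonneg (pow_nonneg x.2.1 n), mul_comm]
    exact mul_le_mul_of_nonneg_right (f.norm_coe_le_norm x) (pow_nonneg x.2.1 n)

end Moments

section Angle

open unitInterval PowerSeries

/-- The weight `2 / (1 + t²)`, the derivative of `2 arctan t`. -/
def angleWeight : C(I, ℝ) := ⟨fun t => 2 / (1 + t ^ 2), by fun_prop (disch := intro; positivity)⟩

/-- The divided power `(2 arctan u)^r / r!`. -/
def arctanPow (r : ℕ) : C(I, ℝ) := ⟨fun u => (2 * Real.arctan u) ^ r / r.factorial, by fun_prop⟩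

lemma arctanPow_zero : arctanPow 0 = 1 := by
  ext u
  simp [arctanPow]

lemma arctanPow_succ_zero (r : ℕ) : arctanPow (r + 1) 0 = 0 := by
  simp [arctanPow]

lemma hasDerivI_arctanPow (r : ℕ) :
    HasDerivI (arctanPow (r + 1)) (angleWeight * arctanPow r) := by
  refine hasDerivI_of_hasDerivAt (fun u => (2 * Real.arctan u) ^ (r + 1) / (r + 1).factorial)
    (fun _ => rfl) fun u => ?_
  refine ((((Real.hasDerivAt_arctan u).const_mul 2).pow (r + 1)).div_const _).congr_deriv ?_
  change _ = 2 / (1 + (u : ℝ) ^ 2) * ((2 * Real.arctan u) ^ r / r.factorial)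
  rw [Nat.factorial_succ, Nat.add_sub_cancel]
  push_cast
  field

/-- The Cayley involution `t ↦ (1 - t) / (1 + t)` of the unit interval. -/
def cayley : C(I, I) where
  toFun t := ⟨(1 - t) / (1 + t), div_nonneg (sub_nonneg.2 t.2.2) (by linarith [t.2.1]),
    (div_le_one (by linarith [t.2.1])).2 (by linarith [t.2.1])⟩
  continuous_toFun := by
    refine Continuous.subtype_mk (Continuous.div (by fun_prop) (by fun_prop) fun t => ?_) _
    linarith [t.2.1]

lemma cayley_one : cayley 1 = 0 := Subtype.ext (by simp [cayley])

lemma coord_mul_one_add_cayley (t : I) : (t : ℝ) * (1 + cayley t) = 1 - cayley t := by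
  have : 1 + (t : ℝ) ≠ 0 := by linarith [t.2.1]
  simp only [cayley, ContinuousMap.coe_mk]
  field

/-- The Jacobian `2 / (1 + t)²` of the Cayley involution `c`, written as `(1 + c)² / 2`. -/
def cayleyWeight : C(I, ℝ) := (1 / 2 : ℝ) • (1 + coord.comp cayley) ^ 2

lemma hasDerivI_cayley : HasDerivI (coord.comp cayley) (-cayleyWeight) := by
  refine hasDerivI_of_hasDerivAt (fun t => (1 - t) / (1 + t)) (fun _ => rfl) fun t => ?_
  have ht : 1 + (t : ℝ) ≠ 0 := by linarith [t.2.1]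
  refine (((hasDerivAt_id (t : ℝ)).const_sub 1).div
    ((hasDerivAt_id (t : ℝ)).const_add 1) ht).congr_deriv ?_
  change _ = -(1 / 2 * (1 + (1 - (t : ℝ)) / (1 + t)) ^ 2)
  simp only [id_eq]
  field

lemma angleWeight_comp_cayley_mul : angleWeight.comp cayley * cayleyWeight = angleWeight := by
  ext t
  have ht : 1 + (t : ℝ) ≠ 0 := by linarith [t.2.1]
  change 2 / (1 + ((1 - (t : ℝ)) / (1 + t)) ^ 2) * (1 / 2 * (1 + (1 - (t : ℝ)) / (1 + t)) ^ 2) =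
    2 / (1 + (t : ℝ) ^ 2)
  rw [show 1 + (1 - (t : ℝ)) / (1 + t) = 2 / (1 + t) by field,
    show 1 + ((1 - (t : ℝ)) / (1 + t)) ^ 2 = 2 * (1 + t ^ 2) / (1 + t) ^ 2 by field]
  field

/-- The divided power `(π/2 - 2 arctan t)^r / r!`, via
`π/4 - arctan t = arctan ((1 - t) / (1 + t))`. -/
def anglePow (r : ℕ) : C(I, ℝ) := (arctanPow r).comp cayley

lemma anglePow_zero : anglePow 0 = 1 := by
  rw [anglePow, arctanPow_zero]
  rfl

lemma anglePow_succ_one (r : ℕ) : anglePow (r + 1) 1 = 0 := by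
  rw [anglePow, ContinuousMap.comp_apply, cayley_one, arctanPow_succ_zero]

lemma hasDerivI_anglePow (r : ℕ) :
    HasDerivI (anglePow (r + 1)) (-(angleWeight * anglePow r)) := by
  have hweight : angleWeight * anglePow r =
      -((angleWeight * arctanPow r).comp cayley * -cayleyWeight) := by
    rw [mul_neg, neg_neg]
    conv_lhs => rw [← angleWeight_comp_cayley_mul]
    exact mul_right_comm ..
  rw [hweight, neg_neg]
  exact (hasDerivI_arctanPow r).comp hasDerivI_cayley

end Angle

section ConnectedSum

open unitInterval PowerSeries

/-- The moments of `t^N (π/2 - 2 arctan t)^d / d!`. -/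
def angleMoment (d N : ℕ) : ℝ⟦X⟧ := moments (coord ^ N * anglePow d)

/-- The moments of `t^N (π/2 - 2 arctan t)^d / d! · 2 / (1 + t²)`. -/
def weightedAngleMoment (d N : ℕ) : ℝ⟦X⟧ := moments (coord ^ N * (anglePow d * angleWeight))

lemma weightedAngleMoment_add (d N : ℕ) :
    weightedAngleMoment d N + weightedAngleMoment d (N + 2) = 2 * angleMoment d N := by
  rw [weightedAngleMoment, weightedAngleMoment, angleMoment, two_mul, ← map_add, ← map_add]
  congr 1
  ext t
  change (t : ℝ) ^ N * (anglePow d t * (2 / (1 + t ^ 2))) +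
    t ^ (N + 2) * (anglePow d t * (2 / (1 + t ^ 2))) = t ^ N * anglePow d t + t ^ N * anglePow d t
  field

lemma angleMoment_zero (N : ℕ) : angleMoment 0 N = geom (N + 1) := by
  rw [angleMoment, anglePow_zero, mul_one, moments_coord_pow]

lemma angleMoment_succ (d N : ℕ) :
    angleMoment (d + 1) N = geom (N + 1) * weightedAngleMoment d (N + 1) := by
  have h := moments_add_coord_mul ((hasDerivI_coord_pow N).mul (hasDerivI_anglePow d))
  have hone : (coord ^ N * anglePow (d + 1)) 1 = 0 := by
    rw [ContinuousMap.mul_apply, anglePow_succ_one, mul_zero]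
  have hsplit : coord ^ N * anglePow (d + 1) + coord * ((N : ℝ) • coord ^ (N - 1) *
      anglePow (d + 1) + coord ^ N * -(angleWeight * anglePow d)) =
      (N + 1 : ℝ) • (coord ^ N * anglePow (d + 1)) -
        coord ^ (N + 1) * (anglePow d * angleWeight) := by
    rw [← smul_mul_assoc, ← coord_pow_add_deriv]
    ring
  rw [hsplit, hone, map_zero, add_zero, map_sub, map_smul, smul_eq_C_mul] at h
  have hrec : (C (N + 1 : ℝ) - X) * angleMoment (d + 1) N = weightedAngleMoment d (N + 1) := by
    rw [angleMoment, weightedAngleMoment]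
    linear_combination h
  rw [← hrec, ← mul_assoc, mul_comm (geom _), C_sub_X_mul_geom (by positivity), one_mul]

/-- The generating series over all weights of the truncated sums `truncT r k (r + e - 1)`:
since `truncT r k` vanishes below `r`, it is convenient to count from there. -/
def truncSeries : ℕ → ℕ → ℝ⟦X⟧
  | 0, _ => 1
  | r + 1, e => ∑ l ∈ Finset.range e, 2 * truncSeries r (l + 1) * geom (2 * l + (r + 1 : ℕ))

/-- The partial sums of the alternating sum in which the innermost `i` variables of a multiple
`T`-series are kept and the remaining ones are replaced by the moment `angleMoment d`. -/
def layer (i d E : ℕ) : ℝ⟦X⟧ :=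
  ∑ e ∈ Finset.range E, (-1) ^ e * (2 * truncSeries i (e + 1) * angleMoment d (2 * e + i))

lemma sum_alternating_mul_eq {R : Type*} [CommRing R] (u v : ℕ → R) (n : ℕ) :
    ∑ e ∈ Finset.range n, (-1) ^ e * (u e * v e) =
      ∑ e ∈ Finset.range n, (-1) ^ e * ((∑ l ∈ Finset.range (e + 1), u l) * (v e + v (e + 1))) +
        (-1) ^ n * ((∑ l ∈ Finset.range n, u l) * v n) := by
  induction n with
  | zero => simp
  | succ n ih =>
    rw [Finset.sum_range_succ, ih, Finset.sum_range_succ _ n, Finset.sum_range_succ u n]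
    ring

lemma layer_succ (i d E : ℕ) :
    layer i (d + 1) E = layer (i + 1) d E +
      (-1) ^ E * (truncSeries (i + 1) E * weightedAngleMoment d (2 * E + (i + 1))) := by
  rw [layer, layer]
  convert sum_alternating_mul_eq
    (fun e => 2 * truncSeries i (e + 1) * geom (2 * e + (i + 1 : ℕ)))
    (fun e => weightedAngleMoment d (2 * e + (i + 1))) E using 3 with e _ e _
  · rw [angleMoment_succ, ← mul_assoc, add_assoc]
    push_cast
    ring_nf
  · rw [show 2 * (e + 1) + (i + 1) = 2 * e + (i + 1) + 2 by ring, weightedAngleMoment_add,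
      truncSeries]
    ring
  · rw [truncSeries]

lemma layer_zero (d E : ℕ) :
    layer 0 d E = weightedAngleMoment d 0 - (-1) ^ E * weightedAngleMoment d (2 * E) := by
  induction E with
  | zero => simp [layer]
  | succ E ih =>
    rw [layer, Finset.sum_range_succ, ← layer, ih, truncSeries, mul_one, add_zero,
      ← weightedAngleMoment_add, mul_add_one]
    ring

lemma coeff_neg_one_pow_mul (n q : ℕ) (f : ℝ⟦X⟧) :
    coeff q ((-1) ^ n * f) = (-1) ^ n * coeff q f := by
  rw [← coeff_C_mul, map_pow, map_neg, map_one]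

lemma coeff_two_mul (q : ℕ) (f : ℝ⟦X⟧) : coeff q (2 * f) = 2 * coeff q f := by
  rw [two_mul, map_add, two_mul]

lemma GrowthLE.coeff_mul {c d : ℝ} {f g : ℕ → ℝ⟦X⟧} (hf : ∀ q, GrowthLE c fun n => coeff q (f n))
    (hg : ∀ q, GrowthLE d fun n => coeff q (g n)) (q : ℕ) :
    GrowthLE (c + d) fun n => coeff q (f n * g n) := by
  simp_rw [PowerSeries.coeff_mul]
  exact GrowthLE.sum fun ab _ => (hf ab.1).mul (hg ab.2)

lemma growthLE_coeff_geom {x : ℝ} (hx : 0 < x) (q : ℕ) :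
    GrowthLE (-1) fun n => coeff q (geom (2 * n + x)) := by
  simp_rw [geom, coeff_mk]
  exact (isSymbol_inv_linear_pow hx q.succ_pos).1

lemma growthLE_coeff_truncSeries (r q : ℕ) : GrowthLE 0 fun e => coeff q (truncSeries r e) := by
  induction r generalizing q with
  | zero => exact growthLE_const _
  | succ r ih =>
    have hterm : ∀ q, GrowthLE (-1) fun l =>
        coeff q (2 * truncSeries r (l + 1) * geom (2 * l + (r + 1 : ℕ))) := fun q => by
      simpa only [mul_assoc, coeff_two_mul, zero_add] using (GrowthLE.coeff_mul
        (fun q => (ih q).shift) (growthLE_coeff_geom (by positivity)) q).const_mul 2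
    simp_rw [truncSeries, map_sum]
    exact (hterm q).sum_range

lemma growthLE_coeff_weightedAngleMoment (d i q : ℕ) :
    GrowthLE (-1) fun e => coeff q (weightedAngleMoment d (2 * e + i)) := by
  refine (((isSymbol_inv_linear_pow (x := i + 1) (by positivity) q.succ_pos).1).const_mul
    ‖anglePow d * angleWeight‖).of_abs_le fun e => ?_
  refine (abs_coeff_moments_coord_pow_mul_le _ _ q).trans (le_of_eq_of_le ?_ (le_abs_self _))
  push_cast
  rw [add_assoc]

lemma tendsto_coeff_layer (i d q : ℕ) :
    Tendsto (fun E => coeff q (layer i d E)) atTop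
      (𝓝 (coeff q (weightedAngleMoment (i + d) 0))) := by
  induction i generalizing d with
  | zero =>
    have hboundary := (growthLE_coeff_weightedAngleMoment d 0 q).alternating.tendsto_zero
      (by norm_num)
    simpa only [layer_zero, map_sub, coeff_neg_one_pow_mul, sub_zero, zero_add]
      using! hboundary.const_sub (coeff q (weightedAngleMoment d 0))
  | succ i ih =>
    have hboundary := (GrowthLE.coeff_mul (growthLE_coeff_truncSeries (i + 1))
      (growthLE_coeff_weightedAngleMoment d (i + 1)) q).alternating.tendsto_zero (by norm_num)
    rw [show i + 1 + d = i + (d + 1) by ring, ← sub_zero (coeff q _)]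
    refine ((ih (d + 1)).sub hboundary).congr fun E => ?_
    rw [layer_succ, map_add, coeff_neg_one_pow_mul, add_sub_cancel_right]

end ConnectedSum

section GeneratingSeries

open PowerSeries

lemma mem_indexSet {w r : ℕ} {k : Fin r → ℕ} :
    k ∈ indexSet w r ↔ ∑ i, k i = w ∧ ∀ i, 0 < k i := by
  rw [indexSet, Finset.mem_filter, Finset.Nat.mem_antidiagonalTuple]

lemma indexSet_zero (w : ℕ) : indexSet w 0 = if w = 0 then {![]} else ∅ := by
  ext k
  rw [mem_indexSet, Finset.univ_eq_empty, Finset.sum_empty, Subsingleton.elim k ![]]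
  split_ifs with h <;> simp [h, eq_comm]

lemma sum_indexSet_succ {M : Type*} [AddCommMonoid M] (r q : ℕ) (f : (Fin r → ℕ) → ℕ → M) :
    ∑ k ∈ indexSet (r + 1 + q) (r + 1), f (Fin.init k) (k (Fin.last r)) =
      ∑ ab ∈ Finset.HasAntidiagonal.antidiagonal q,
        ∑ k ∈ indexSet (r + ab.1) r, f k (ab.2 + 1) := by
  rw [Finset.sum_sigma']
  symm
  refine Finset.sum_bij' (fun x _ => (Fin.snoc x.2 (x.1.2 + 1) : Fin (r + 1) → ℕ))
    (fun k _ => ⟨(∑ i, Fin.init k i - r, k (Fin.last r) - 1), Fin.init k⟩) ?_ ?_ ?_ ?_ ?_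
  · rintro ⟨⟨a, b⟩, k⟩ h
    simp only [Finset.mem_sigma, Finset.HasAntidiagonal.mem_antidiagonal, mem_indexSet] at h
    rw [mem_indexSet, Fin.sum_univ_castSucc, Fin.forall_fin_succ']
    simp only [Fin.snoc_castSucc, Fin.snoc_last]
    exact ⟨by omega, h.2.2, b.succ_pos⟩
  · intro k h
    obtain ⟨hsum, hpos⟩ := mem_indexSet.1 h
    have hdepth : r ≤ ∑ i, Fin.init k i := by
      simpa using! Finset.card_nsmul_le_sum Finset.univ (Fin.init k) 1 fun i _ => hpos i.castSucc
    have hweight : ∑ i, Fin.init k i + k (Fin.last r) = r + 1 + q :=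
      (Fin.sum_univ_castSucc k).symm.trans hsum
    have hlast := hpos (Fin.last r)
    simp only [Finset.mem_sigma, Finset.HasAntidiagonal.mem_antidiagonal, mem_indexSet]
    exact ⟨by omega, by omega, fun i => hpos i.castSucc⟩
  · rintro ⟨⟨a, b⟩, k⟩ h
    simp only [Finset.mem_sigma, mem_indexSet] at h
    simp only [Fin.init_snoc, Fin.snoc_last, h.2.1, Nat.add_sub_cancel_left, Nat.add_sub_cancel]
  · intro k h
    simp only [Nat.sub_add_cancel ((mem_indexSet.1 h).2 (Fin.last r)), Fin.snoc_init_self]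
  · rintro ⟨⟨a, b⟩, k⟩ _
    simp only [Fin.init_snoc, Fin.snoc_last]

lemma coeff_two_mul_mul_geom {r q : ℕ} {F : ℝ⟦X⟧} {a : (Fin r → ℕ) → ℝ}
    (hF : ∀ q, coeff q F = ∑ k ∈ indexSet (r + q) r, a k) (x : ℝ) :
    coeff q (2 * F * geom x) = ∑ k ∈ indexSet (r + 1 + q) (r + 1),
      2 * a (Fin.init k) * x⁻¹ ^ k (Fin.last r) := by
  rw [sum_indexSet_succ r q fun k n => 2 * a k * x⁻¹ ^ n, mul_assoc, coeff_two_mul, coeff_mul,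
    Finset.mul_sum]
  refine Finset.sum_congr rfl fun ab _ => ?_
  rw [hF, geom, coeff_mk, ← mul_assoc, Finset.mul_sum, Finset.sum_mul]

lemma coeff_truncSeries (r e q : ℕ) :
    coeff q (truncSeries r (e + 1)) = ∑ k ∈ indexSet (r + q) r, truncT r k (r + e) := by
  induction r generalizing e q with
  | zero =>
    rw [truncSeries, coeff_one, zero_add, indexSet_zero]
    split_ifs <;> simp [truncT]
  | succ r ih =>
    simp_rw [truncSeries, map_sum, truncT_succ_add]
    rw [Finset.sum_comm]
    exact Finset.sum_congr rfl fun l _ => coeff_two_mul_mul_geom (ih l) _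

theorem W_eq_coeff_weightedAngleMoment (r q : ℕ) :
    W (r + 1 + q) (r + 1) = (-1) ^ (r + 1) * coeff q (weightedAngleMoment r 0) := by
  have hterm : ∀ e, (-1) ^ (r + 1) * coeff q ((-1) ^ e *
      (2 * truncSeries r (e + 1) * angleMoment 0 (2 * e + r))) =
      ∑ k ∈ indexSet (r + 1 + q) (r + 1), altTTerm (r + 1) k (r + 1 + e) := fun e => by
    rw [angleMoment_zero, coeff_neg_one_pow_mul, coeff_two_mul_mul_geom (coeff_truncSeries r e)]
    simp_rw [Finset.mul_sum, altTTerm_succ_add]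
    refine Finset.sum_congr rfl fun k _ => ?_
    push_cast
    ring_nf
  have hsum : HasSeries (fun n => ∑ k ∈ indexSet (r + 1 + q) (r + 1), altTTerm (r + 1) k n)
      ((-1) ^ (r + 1) * coeff q (weightedAngleMoment r 0)) := by
    refine hasSeries_of_shift (fun n hn hr => Finset.sum_eq_zero fun k _ =>
      altTTerm_eq_zero k hn hr) (((tendsto_coeff_layer r 0 q).const_mul _).congr fun E => ?_)
    rw [layer, map_sum, Finset.mul_sum, Finset.sum_congr rfl fun e _ => hterm e]
  exact (HasSeries.sum fun k hk =>
    (altTTerm_converges (mem_indexSet.1 hk).2).hasSeries).unique hsum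

end GeneratingSeries

section Recurrence

open PowerSeries

/-- The sequence of power series with initial values `a`, `b` and
`s (k + 2) = ε s k + 2 X / (k + 1) s (k + 1)`. For `ε = 1` this is the recurrence of the moments of
the powers of the Cayley involution, for `ε = -1` that of the Taylor coefficients of the powers of
`2 arctan`. -/
def recSeq (ε : ℝ) (a b : ℝ⟦X⟧) : ℕ → ℝ⟦X⟧
  | 0 => a
  | 1 => b
  | k + 2 => C ε * recSeq ε a b k + C (2 / (k + 1 : ℝ)) * (X * recSeq ε a b (k + 1))

variable {ε : ℝ} {a b : ℝ⟦X⟧}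

lemma coeff_zero_recSeq_add_two (k : ℕ) :
    coeff 0 (recSeq ε a b (k + 2)) = ε * coeff 0 (recSeq ε a b k) := by
  rw [recSeq, map_add, coeff_C_mul, coeff_C_mul, coeff_zero_X_mul, mul_zero, add_zero]

lemma coeff_succ_recSeq_add_two (q k : ℕ) :
    coeff (q + 1) (recSeq ε a b (k + 2)) =
      ε * coeff (q + 1) (recSeq ε a b k) + 2 / (k + 1) * coeff q (recSeq ε a b (k + 1)) := by
  rw [recSeq, map_add, coeff_C_mul, coeff_C_mul, coeff_succ_X_mul]

lemma recSeq_eq (k : ℕ) :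
    recSeq ε a b k = a * recSeq ε 1 0 k + b * recSeq ε 0 1 k := by
  induction k using Nat.twoStepInduction with
  | zero => simp only [recSeq, mul_one, mul_zero, add_zero]
  | one => simp only [recSeq, mul_one, mul_zero, zero_add]
  | more k ih ih' =>
    simp only [recSeq, ih, ih']
    ring

lemma growthLE_two_div_succ : GrowthLE (-1) fun n => 2 / (n + 1 : ℝ) :=
  ((growthLE_inv_linear zero_le_two).const_mul 4).of_abs_le fun n => by
    rw [show (2 * n + 2 : ℝ) = 2 * (n + 1) by ring, mul_inv, ← mul_assoc, div_eq_mul_inv]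
    norm_num

lemma growthLE_coeff_recSeq (hε : |ε| = 1) (q : ℕ) :
    GrowthLE 0 fun k => coeff q (recSeq ε a b k) := by
  have hstep : ∀ x y : ℝ, |ε * x + y| ≤ |x| + |y| := fun x y =>
    (abs_add_le _ _).trans_eq (by rw [abs_mul, hε, one_mul])
  induction q with
  | zero =>
    refine growthLE_of_two_step (b := fun _ => 0)
      (growthLE_two_div_succ.of_abs_le fun _ => abs_zero.trans_le (abs_nonneg _)) fun k => ?_
    simpa only [coeff_zero_recSeq_add_two, add_zero] using hstep (coeff 0 (recSeq ε a b k)) 0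
  | succ q ih =>
    have hb : GrowthLE (-1) fun k : ℕ => 2 / (k + 1 : ℝ) * coeff q (recSeq ε a b (k + 1)) := by
      simpa only [add_zero] using growthLE_two_div_succ.mul ih.shift
    refine growthLE_of_two_step hb fun k => ?_
    rw [coeff_succ_recSeq_add_two]
    exact hstep _ _

end Recurrence

section CayleyMoments

open PowerSeries

lemma hasDerivI_one_add_cayley : HasDerivI (1 + coord.comp cayley) (-cayleyWeight) := by
  simpa only [zero_add] using! (hasDerivI_const 1).add hasDerivI_cayley

lemma moments_cayleyWeight :
    moments cayleyWeight = X * moments (1 + coord.comp cayley) + 1 := by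
  have h := moments_add_coord_mul hasDerivI_one_add_cayley
  have hone : (1 + coord.comp cayley) 1 = 1 := by
    change 1 + (cayley 1 : ℝ) = 1
    rw [cayley_one, Set.Icc.coe_zero, add_zero]
  rw [hone, map_one] at h
  rw [← h]
  congr 1
  ext t
  change 1 / 2 * (1 + (cayley t : ℝ)) ^ 2 =
    1 + (cayley t : ℝ) + t * -(1 / 2 * (1 + (cayley t : ℝ)) ^ 2)
  linear_combination (1 + (cayley t : ℝ)) / 2 * coord_mul_one_add_cayley t

lemma hasDerivI_one_add_coord_sq_mul_coord_pow (k : ℕ) :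
    HasDerivI ((1 + coord) ^ 2 * coord ^ k)
      (2 * (1 + coord) * coord ^ k + (1 + coord) ^ 2 * ((k : ℝ) • coord ^ (k - 1))) :=
  hasDerivI_of_hasDerivAt (fun u => (1 + u) ^ 2 * u ^ k) (fun _ => rfl) fun u => by
    refine ((((hasDerivAt_id (u : ℝ)).const_add 1).pow 2).mul
      (hasDerivAt_pow k (u : ℝ))).congr_deriv ?_
    simp only [id_eq, mul_one, Nat.cast_ofNat, Nat.add_one_sub_one, pow_one]
    rfl

lemma moments_cayley_pow_succ (k : ℕ) :
    (k + 2 : ℝ) • moments (coord.comp cayley ^ (k + 1) * cayleyWeight) =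
      (k : ℝ) • moments (coord.comp cayley ^ (k - 1) * cayleyWeight) +
        (2 : ℝ) • (X * moments (coord.comp cayley ^ k * cayleyWeight)) + C (0 ^ k) := by
  have h := moments_add_coord_mul
    ((hasDerivI_one_add_coord_sq_mul_coord_pow k).comp hasDerivI_cayley)
  have hone : (((1 + coord) ^ 2 * coord ^ k).comp cayley) 1 = 0 ^ k := by
    change (1 + (cayley 1 : ℝ)) ^ 2 * (cayley 1 : ℝ) ^ k = 0 ^ k
    rw [cayley_one, Set.Icc.coe_zero, add_zero, one_pow, one_mul]
  have hmul : ((1 + coord) ^ 2 * coord ^ k).comp cayley =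
      (2 : ℝ) • (coord.comp cayley ^ k * cayleyWeight) := by
    ext t
    change (1 + (cayley t : ℝ)) ^ 2 * (cayley t : ℝ) ^ k =
      2 * ((cayley t : ℝ) ^ k * (1 / 2 * (1 + (cayley t : ℝ)) ^ 2))
    ring
  have hsplit : ((1 + coord) ^ 2 * coord ^ k).comp cayley + coord * ((2 * (1 + coord) * coord ^ k +
      (1 + coord) ^ 2 * ((k : ℝ) • coord ^ (k - 1))).comp cayley * -cayleyWeight) =
      (k + 2 : ℝ) • (coord.comp cayley ^ (k + 1) * cayleyWeight) -
        (k : ℝ) • (coord.comp cayley ^ (k - 1) * cayleyWeight) := by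
    ext t
    have hpow : (k : ℝ) * ((cayley t : ℝ) ^ (k - 1) * cayley t) = k * (cayley t : ℝ) ^ k := by
      cases k <;> simp [pow_succ]
    change (1 + (cayley t : ℝ)) ^ 2 * (cayley t : ℝ) ^ k + t * ((2 * (1 + (cayley t : ℝ)) *
      (cayley t : ℝ) ^ k + (1 + (cayley t : ℝ)) ^ 2 * (k * (cayley t : ℝ) ^ (k - 1))) *
        -(1 / 2 * (1 + (cayley t : ℝ)) ^ 2)) =
      (k + 2) * ((cayley t : ℝ) ^ (k + 1) * (1 / 2 * (1 + (cayley t : ℝ)) ^ 2)) -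
        k * ((cayley t : ℝ) ^ (k - 1) * (1 / 2 * (1 + (cayley t : ℝ)) ^ 2))
    linear_combination (1 + (cayley t : ℝ)) ^ 2 / 2 * ((cayley t : ℝ) * hpow -
      (2 * (cayley t : ℝ) ^ k + (1 + (cayley t : ℝ)) * (k * (cayley t : ℝ) ^ (k - 1))) *
        coord_mul_one_add_cayley t)
  rw [hsplit, hone, hmul, map_sub, map_smul, map_smul, map_smul, sub_eq_iff_eq_add'] at h
  rw [h, add_assoc, mul_smul_comm]

/-- The moments of `k c^(k-1) w`, where `c` is the Cayley involution and `w` its weight; for `k = 0`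
the value `1` continues the recurrence. -/
def cayleyMoment (k : ℕ) : ℝ⟦X⟧ := recSeq 1 1 (moments cayleyWeight) k

theorem moments_cayley_pow (k : ℕ) :
    (k + 1 : ℝ) • moments (coord.comp cayley ^ k * cayleyWeight) = cayleyMoment (k + 1) := by
  rw [cayleyMoment]
  induction k using Nat.twoStepInduction with
  | zero => simp [recSeq]
  | one =>
    have h : (2 : ℝ) • moments (coord.comp cayley ^ 1 * cayleyWeight) =
        (2 : ℝ) • (X * moments cayleyWeight) + 1 := by
      simpa using moments_cayley_pow_succ 0
    rw [recSeq, recSeq, recSeq, Nat.cast_one, one_add_one_eq_two, h, Nat.cast_zero, zero_add,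
      div_one, map_one, mul_one, add_comm, smul_eq_C_mul]
  | more k ih ih' =>
    have h := moments_cayley_pow_succ (k + 1)
    have hcancel : (2 / ((k + 1 : ℕ) + 1) : ℝ) * ((k + 1 : ℕ) + 1) = 2 :=
      div_mul_cancel₀ _ (by positivity)
    rw [recSeq, ← ih, ← ih', map_one, one_mul, ← smul_eq_C_mul, mul_smul_comm, smul_smul, hcancel]
    rw [zero_pow k.succ_ne_zero, map_zero, add_zero, Nat.add_sub_cancel] at h
    convert h using 2
    · push_cast
      ring_nf
    · rw [Nat.cast_add_one]

lemma hasSeries_zetaBarTerm (q : ℕ) :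
    HasSeries (zetaBarTerm (q + 1)) (1 / 2 * coeff q (moments (1 + coord.comp cayley))) := by
  have hpartial : ∀ N, ∑ k ∈ Finset.range N, zetaBarTerm (q + 1) (k + 1) =
      1 / 2 * (coeff q (moments (1 + coord.comp cayley)) -
        (-1) ^ N * coeff q (moments (coord ^ N * (1 + coord.comp cayley)))) := fun N => by
    induction N with
    | zero => simp
    | succ N ih =>
      have hstep : coord ^ N * (1 + coord.comp cayley) + coord ^ (N + 1) * (1 + coord.comp cayley) =
          (2 : ℝ) • coord ^ N := by
        ext t
        change (t : ℝ) ^ N * (1 + cayley t) + t ^ (N + 1) * (1 + cayley t) = 2 * t ^ N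
        linear_combination (t : ℝ) ^ N * coord_mul_one_add_cayley t
      have hcoeff := congrArg (coeff q ∘ moments) hstep
      simp only [Function.comp_apply, map_add, map_smul, moments_coord_pow, geom, coeff_mk,
        smul_eq_mul] at hcoeff
      rw [Finset.sum_range_succ, ih, zetaBarTerm, Nat.add_sub_cancel, div_eq_mul_inv _ (_ ^ _),
        ← inv_pow]
      push_cast
      linear_combination (-1 / 2) * (-1) ^ N * hcoeff
  have hboundary : Tendsto
      (fun N => (-1) ^ N * coeff q (moments (coord ^ N * (1 + coord.comp cayley)))) atTop
      (𝓝 0) := by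
    refine squeeze_zero_norm (a := fun N : ℕ =>
      ‖1 + coord.comp cayley‖ * (1 / (N + 1 : ℝ)) ^ (q + 1)) (fun N => ?_) ?_
    · rw [Real.norm_eq_abs, abs_mul, abs_neg_one_pow, one_mul, one_div]
      exact abs_coeff_moments_coord_pow_mul_le ..
    · simpa using (tendsto_one_div_add_atTop_nhds_zero_nat.pow (q + 1)).const_mul
        ‖1 + coord.comp cayley‖
  refine hasSeries_iff_range.2 ?_
  simpa only [hpartial, sub_zero] using (hboundary.const_sub _).const_mul (1 / 2)

theorem zetaBarTerm_converges {s : ℕ} (hs : 1 ≤ s) : SeriesConverges (zetaBarTerm s) := by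
  obtain ⟨q, rfl⟩ := Nat.exists_eq_add_of_le' hs
  exact (hasSeries_zetaBarTerm q).seriesConverges

theorem coeff_moments_cayleyWeight (q : ℕ) : coeff q (moments cayleyWeight) = 2 * zetaBar q := by
  rw [moments_cayleyWeight, map_add]
  cases q with
  | zero => simp [zetaBar]
  | succ q =>
    rw [coeff_succ_X_mul, coeff_one, if_neg q.succ_ne_zero, zetaBar, if_neg q.succ_ne_zero,
      (hasSeries_zetaBarTerm q).series_eq]
    ring

end CayleyMoments

section ArctanSeries

open unitInterval PowerSeries

/-- The numbers `α_r k` for which `(2 arctan u)^(r+1) / (r+1)! = ∑_{k ≥ 1} 2 α_r k / k u^k`. -/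
def arctanCoeff (r k : ℕ) : ℝ := coeff r (recSeq (-1) 0 1 k)

/-- The partial sums of the Taylor series of `arctanPow r`. -/
def arctanPartial : ℕ → ℕ → C(I, ℝ)
  | 0, _ => 1
  | r + 1, K => ∑ k ∈ Finset.range K, (2 * arctanCoeff r (k + 1) / (k + 1 : ℝ)) • coord ^ (k + 1)

/-- The derivative of `arctanPartial (r + 1) K`. -/
def arctanPartialDeriv (r K : ℕ) : C(I, ℝ) :=
  ∑ k ∈ Finset.range K, (2 * arctanCoeff r (k + 1)) • coord ^ k

/-- A bound for the coefficients of the boundary terms that appear when the differential equation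
of `arctanPow` is applied to its partial sums. -/
def arctanError (r K : ℕ) : ℝ := 2 * (|arctanCoeff r K| + |arctanCoeff r (K + 1)|)

lemma growthLE_arctanError (r : ℕ) : GrowthLE 0 (arctanError r) := by
  have hcoeff : GrowthLE 0 fun K => |arctanCoeff r K| :=
    (growthLE_coeff_recSeq (by norm_num) r).of_abs_le fun _ => (abs_abs _).le
  exact (hcoeff.add hcoeff.shift).const_mul 2

lemma hasDerivI_arctanPartial (r K : ℕ) :
    HasDerivI (arctanPartial (r + 1) K) (arctanPartialDeriv r K) := by
  refine HasDerivI.sum fun k _ => ?_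
  have hk : (k + 1 : ℝ) ≠ 0 := by positivity
  convert (hasDerivI_coord_pow (k + 1)).smul (2 * arctanCoeff r (k + 1) / (k + 1 : ℝ)) using 1
  rw [smul_smul, Nat.cast_add_one, div_mul_cancel₀ _ hk, Nat.add_sub_cancel]

lemma arctanPartial_succ_zero (r K : ℕ) : arctanPartial (r + 1) K 0 = 0 := by
  rw [arctanPartial, ContinuousMap.sum_apply]
  exact Finset.sum_eq_zero fun k _ => by simp [coord]

lemma two_smul_arctanPartial_succ_sub (r K : ℕ) :
    (2 : ℝ) • (arctanPartial r (K + 1) - arctanPartial r K) =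
      (2 * (arctanCoeff r K + arctanCoeff r (K + 2))) • coord ^ (K + 1) := by
  cases r with
  | zero =>
    rw [arctanCoeff, arctanCoeff, coeff_zero_recSeq_add_two, neg_one_mul, add_neg_cancel, mul_zero,
      zero_smul, arctanPartial, arctanPartial, sub_self, smul_zero]
  | succ r =>
    have hcoeff : arctanCoeff (r + 1) K + arctanCoeff (r + 1) (K + 2) =
        2 * arctanCoeff r (K + 1) / (K + 1 : ℝ) := by
      rw [arctanCoeff, arctanCoeff, arctanCoeff, coeff_succ_recSeq_add_two]
      ring
    rw [arctanPartial, arctanPartial, Finset.sum_range_succ, add_sub_cancel_left, hcoeff, smul_smul]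

lemma one_add_sq_mul_arctanPartialDeriv (r K : ℕ) :
    (1 + coord ^ 2) * arctanPartialDeriv r (K + 1) =
      (2 : ℝ) • (arctanPartial r K + arctanCoeff r K • coord ^ (K + 1) +
        arctanCoeff r (K + 1) • coord ^ (K + 2)) := by
  induction K with
  | zero =>
    have hzero : arctanCoeff r 0 = 0 := by rw [arctanCoeff, recSeq, map_zero]
    have hone : arctanPartial r 0 = arctanCoeff r 1 • 1 := by
      rw [arctanCoeff, recSeq, coeff_one]
      cases r <;> simp [arctanPartial]
    rw [arctanPartialDeriv, Finset.sum_range_one, hzero, hone]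
    simp only [Algebra.smul_def, map_mul, map_zero, map_ofNat]
    ring
  | succ K ih =>
    have hstep := two_smul_arctanPartial_succ_sub r K
    rw [arctanPartialDeriv, Finset.sum_range_succ, ← arctanPartialDeriv, mul_add, ih]
    simp only [Algebra.smul_def, map_mul, map_add, map_ofNat] at hstep ⊢
    linear_combination -hstep

lemma arctanPartialDeriv_succ (r K : ℕ) :
    arctanPartialDeriv r (K + 1) = angleWeight * (arctanPartial r K +
      arctanCoeff r K • coord ^ (K + 1) + arctanCoeff r (K + 1) • coord ^ (K + 2)) := by
  have hweight : angleWeight * (1 + coord ^ 2) = (2 : ℝ) • 1 := by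
    ext u
    change 2 / (1 + (u : ℝ) ^ 2) * (1 + u ^ 2) = 2 * 1
    field
  have h := congrArg (angleWeight * ·) (one_add_sq_mul_arctanPartialDeriv r K)
  simp only [← mul_assoc, hweight, mul_smul_comm, smul_mul_assoc, one_mul] at h
  exact smul_right_injective _ two_ne_zero h

lemma abs_arctanPartialDeriv_sub_le (r K : ℕ) (u : I) :
    |(arctanPartialDeriv r (K + 1) - angleWeight * arctanPow r) u| ≤
      2 * ‖arctanPartial r K - arctanPow r‖ + arctanError r K * u ^ (K + 1) := by
  have hnonneg : 0 ≤ angleWeight u := by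
    change 0 ≤ 2 / (1 + (u : ℝ) ^ 2)
    positivity
  have hle : angleWeight u ≤ 2 := div_le_self zero_le_two (by nlinarith [sq_nonneg (u : ℝ)])
  have hu : (0 : ℝ) ≤ u ^ (K + 1) := pow_nonneg u.2.1 _
  have hdiff := (arctanPartial r K - arctanPow r).norm_coe_le_norm u
  rw [arctanPartialDeriv_succ, ← mul_sub, ContinuousMap.mul_apply, abs_mul, abs_of_nonneg hnonneg]
  rw [arctanError, mul_assoc, ← mul_add]
  refine mul_le_mul hle ?_ (abs_nonneg _) zero_le_two
  calc |(arctanPartial r K + arctanCoeff r K • coord ^ (K + 1) +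
          arctanCoeff r (K + 1) • coord ^ (K + 2) - arctanPow r) u|
      = |(arctanPartial r K - arctanPow r) u + (arctanCoeff r K +
          arctanCoeff r (K + 1) * u) * u ^ (K + 1)| := congrArg abs <| by
        change arctanPartial r K u + arctanCoeff r K * (u : ℝ) ^ (K + 1) +
          arctanCoeff r (K + 1) * (u : ℝ) ^ (K + 2) - arctanPow r u =
            arctanPartial r K u - arctanPow r u +
              (arctanCoeff r K + arctanCoeff r (K + 1) * u) * (u : ℝ) ^ (K + 1)
        ring
    _ ≤ ‖arctanPartial r K - arctanPow r‖ + (|arctanCoeff r K| + |arctanCoeff r (K + 1)| * 1) *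
          u ^ (K + 1) := by
        refine (abs_add_le _ _).trans (add_le_add hdiff ?_)
        rw [abs_mul, abs_of_nonneg hu]
        gcongr
        refine (abs_add_le _ _).trans ?_
        rw [abs_mul, abs_of_nonneg u.2.1]
        gcongr
        exact u.2.2
    _ = _ := by rw [mul_one]

lemma norm_arctanPartial_succ_sub_le (r K : ℕ) :
    ‖arctanPartial (r + 1) (K + 1) - arctanPow (r + 1)‖ ≤
      2 * ‖arctanPartial r K - arctanPow r‖ + arctanError r K / ((K + 1 : ℕ) + 1) := by
  have herror : 0 ≤ arctanError r K := by
    rw [arctanError]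
    positivity
  refine (ContinuousMap.norm_le _ (by positivity)).2 fun u => ?_
  refine abs_le_of_abs_deriv_le ((hasDerivI_arctanPartial r (K + 1)).sub (hasDerivI_arctanPow r))
    ?_ herror (abs_arctanPartialDeriv_sub_le r K) u
  rw [ContinuousMap.sub_apply, arctanPartial_succ_zero, arctanPow_succ_zero, sub_zero]

lemma tendsto_norm_arctanPartial_sub (r : ℕ) :
    Tendsto (fun K => ‖arctanPartial r K - arctanPow r‖) atTop (𝓝 0) := by
  induction r with
  | zero => simp [arctanPartial, arctanPow_zero]
  | succ r ih =>
    have herror : Tendsto (fun K => arctanError r K / ((K + 1 : ℕ) + 1)) atTop (𝓝 0) := by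
      have h := ((growthLE_arctanError r).mul growthLE_two_div_succ.shift).const_mul (1 / 2)
      refine (h.tendsto_zero (by norm_num)).congr fun K => by ring
    refine (tendsto_add_atTop_iff_nat 1).1 (squeeze_zero (fun _ => norm_nonneg _)
      (norm_arctanPartial_succ_sub_le r) ?_)
    simpa only [mul_zero, add_zero] using (ih.const_mul 2).add herror

end ArctanSeries

section CayleyExpansion

open unitInterval PowerSeries

lemma moments_arctanPartialDeriv_comp (r K : ℕ) :
    moments ((arctanPartialDeriv r K).comp cayley * cayleyWeight) =
      ∑ k ∈ Finset.range K, (2 * arctanCoeff r (k + 1) / (k + 1 : ℕ)) •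
        cayleyMoment (k + 1) := by
  have hcomp : (arctanPartialDeriv r K).comp cayley * cayleyWeight =
      ∑ k ∈ Finset.range K,
        (2 * arctanCoeff r (k + 1)) • (coord.comp cayley ^ k * cayleyWeight) := by
    ext t
    simp only [arctanPartialDeriv, ContinuousMap.mul_apply, ContinuousMap.comp_apply,
      ContinuousMap.sum_apply, Finset.sum_mul]
    exact Finset.sum_congr rfl fun k _ => mul_assoc ..
  rw [hcomp, map_sum]
  refine Finset.sum_congr rfl fun k _ => ?_
  rw [← moments_cayley_pow, map_smul, smul_smul, Nat.cast_add_one, div_mul_cancel₀]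
  positivity

lemma abs_coeff_moments_arctanPartialDeriv_sub_le (r q K : ℕ) :
    |coeff q (moments ((arctanPartialDeriv r (K + 1) - angleWeight * arctanPow r).comp cayley *
      cayleyWeight))| ≤
    2 * ‖arctanPartial r K - arctanPow r‖ * coeff q (moments cayleyWeight) +
      arctanError r K * coeff q (moments (coord.comp cayley ^ (K + 1) * cayleyWeight)) := by
  refine (abs_coeff_moments_le (g := (2 * ‖arctanPartial r K - arctanPow r‖) • cayleyWeight +
    arctanError r K • (coord.comp cayley ^ (K + 1) * cayleyWeight)) (fun t => ?_) q).trans_eq ?_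
  · have hweight : 0 ≤ cayleyWeight t := by
      change 0 ≤ 1 / 2 * (1 + (cayley t : ℝ)) ^ 2
      positivity
    rw [ContinuousMap.mul_apply, abs_mul, abs_of_nonneg hweight]
    refine (mul_le_mul_of_nonneg_right
      (abs_arctanPartialDeriv_sub_le r K (cayley t)) hweight).trans_eq ?_
    rw [add_mul, mul_assoc (arctanError r K)]
    rfl
  · rw [map_add, map_smul, map_smul, map_add, coeff_smul, coeff_smul, smul_eq_mul, smul_eq_mul]

lemma tendsto_arctanError_mul_coeff (r q : ℕ) :
    Tendsto (fun K => arctanError r K *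
      coeff q (moments (coord.comp cayley ^ (K + 1) * cayleyWeight))) atTop (𝓝 0) := by
  have h := ((growthLE_arctanError r).mul (growthLE_two_div_succ.mul (growthLE_coeff_recSeq
    (ε := 1) (a := 1) (b := moments cayleyWeight) abs_one q).shift).shift).const_mul (1 / 2)
  refine (h.tendsto_zero (by norm_num)).congr fun K => ?_
  rw [← cayleyMoment, ← moments_cayley_pow, map_smul, smul_eq_mul]
  field

theorem hasSeries_cayley_expansion (r q : ℕ) :
    HasSeries (fun k => 2 * arctanCoeff r k / k * coeff q (cayleyMoment k))
      (coeff q (weightedAngleMoment r 0)) := by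
  have hweight : weightedAngleMoment r 0 =
      moments ((angleWeight * arctanPow r).comp cayley * cayleyWeight) := by
    rw [weightedAngleMoment, pow_zero, one_mul, anglePow]
    conv_lhs => rw [← angleWeight_comp_cayley_mul]
    exact congrArg moments ((mul_left_comm ..).trans (mul_assoc ..).symm)
  have hpartial : ∀ K, ∑ k ∈ Finset.range (K + 1), 2 * arctanCoeff r (k + 1) / (k + 1 : ℕ) *
      coeff q (cayleyMoment (k + 1)) =
      coeff q (moments ((arctanPartialDeriv r (K + 1)).comp cayley * cayleyWeight)) := fun K => by
    simp only [moments_arctanPartialDeriv_comp, map_sum, map_smul, smul_eq_mul]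
  have hbound := (((tendsto_norm_arctanPartial_sub r).const_mul 2).mul_const
    (coeff q (moments cayleyWeight))).add (tendsto_arctanError_mul_coeff r q)
  rw [mul_zero, zero_mul, add_zero] at hbound
  refine hasSeries_iff_range.2 ((tendsto_add_atTop_iff_nat 1).1 ?_)
  rw [hweight, tendsto_iff_norm_sub_tendsto_zero]
  simp only [hpartial, ← map_sub, ← sub_mul]
  exact squeeze_zero (fun _ => norm_nonneg _)
    (abs_coeff_moments_arctanPartialDeriv_sub_le r q) hbound

end CayleyExpansion

section ClosedForms

open PowerSeries

variable {ε : ℝ} {a b : ℝ⟦X⟧}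

lemma coeff_zero_recSeq_even (n : ℕ) : coeff 0 (recSeq ε a b (2 * n)) = ε ^ n * coeff 0 a := by
  induction n with
  | zero => rw [pow_zero, one_mul, mul_zero, recSeq]
  | succ n ih => rw [mul_add_one, coeff_zero_recSeq_add_two, ih, pow_succ', mul_assoc]

lemma coeff_zero_recSeq_odd (n : ℕ) : coeff 0 (recSeq ε a b (2 * n + 1)) = ε ^ n * coeff 0 b := by
  induction n with
  | zero => rw [pow_zero, one_mul, mul_zero, zero_add, recSeq]
  | succ n ih =>
    rw [mul_add_one, add_right_comm, coeff_zero_recSeq_add_two, ih, pow_succ', mul_assoc]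

lemma coeff_succ_recSeq_even (hε : ε * ε = 1) (q n : ℕ) :
    coeff (q + 1) (recSeq ε a b (2 * n)) = ε ^ n * (coeff (q + 1) a +
      ∑ l ∈ Finset.range n, ε ^ (l + 1) * (2 * coeff q (recSeq ε a b (2 * l + 1)) *
        (2 * l + 1 : ℝ)⁻¹)) := by
  induction n with
  | zero => rw [Finset.sum_range_zero, pow_zero, one_mul, add_zero, mul_zero, recSeq]
  | succ n ih =>
    have hpow : ε ^ (n + 1) * ε ^ (n + 1) = 1 := by rw [← mul_pow, hε, one_pow]
    rw [mul_add_one, coeff_succ_recSeq_add_two, ih, Finset.sum_range_succ]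
    push_cast
    linear_combination (-2 * coeff q (recSeq ε a b (2 * n + 1)) * (2 * n + 1 : ℝ)⁻¹) * hpow

lemma coeff_succ_recSeq_odd (hε : ε * ε = 1) (q n : ℕ) :
    coeff (q + 1) (recSeq ε a b (2 * n + 1)) = ε ^ n * (coeff (q + 1) b +
      ∑ l ∈ Finset.range n, ε ^ (l + 1) * (2 * coeff q (recSeq ε a b (2 * (l + 1))) *
        (2 * l + 2 : ℝ)⁻¹)) := by
  induction n with
  | zero => rw [Finset.sum_range_zero, pow_zero, one_mul, add_zero, mul_zero, zero_add, recSeq]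
  | succ n ih =>
    have hpow : ε ^ (n + 1) * ε ^ (n + 1) = 1 := by rw [← mul_pow, hε, one_pow]
    rw [mul_add_one, add_right_comm, coeff_succ_recSeq_add_two, ih, Finset.sum_range_succ,
      show 2 * n + 1 + 1 = 2 * (n + 1) by ring]
    push_cast
    rw [show (2 * n + 1 + 1 : ℝ) = 2 * n + 2 by ring]
    linear_combination (-2 * coeff q (recSeq ε a b (2 * (n + 1))) * (2 * n + 2 : ℝ)⁻¹) * hpow

lemma coeff_recSeq_zero_one_of_even {q k : ℕ} (h : Even (q + k)) :
    coeff q (recSeq ε 0 1 k) = 0 := by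
  induction k using Nat.twoStepInduction generalizing q with
  | zero => rw [recSeq, map_zero]
  | one => rw [recSeq, coeff_one, if_neg (by grind)]
  | more k ih ih' =>
    cases q with
    | zero => rw [coeff_zero_recSeq_add_two, ih (by grind), mul_zero]
    | succ q =>
      rw [coeff_succ_recSeq_add_two, ih (by grind), ih' (by grind), mul_zero, mul_zero, add_zero]

lemma coeff_recSeq_one_zero_of_odd {q k : ℕ} (h : Odd (q + k)) :
    coeff q (recSeq ε 1 0 k) = 0 := by
  induction k using Nat.twoStepInduction generalizing q with
  | zero => rw [recSeq, coeff_one, if_neg (by grind)]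
  | one => rw [recSeq, map_zero]
  | more k ih ih' =>
    cases q with
    | zero => rw [coeff_zero_recSeq_add_two, ih (by grind), mul_zero]
    | succ q =>
      rw [coeff_succ_recSeq_add_two, ih (by grind), ih' (by grind), mul_zero, mul_zero, add_zero]

lemma coeff_recSeq_even_of_odd (hε : ε * ε = 1) {j : ℕ}
    (hodd : ∀ n, coeff (2 * j) (recSeq ε 0 1 (2 * n + 1)) =
      ε ^ (n + j) * tSum (2 * j) (ones _) (n + 1)) (n : ℕ) :
    coeff (2 * j + 1) (recSeq ε 0 1 (2 * n)) = ε ^ (n + j + 1) * tSum (2 * j + 1) (ones _) n := by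
  have hpow : ∀ l, ε ^ l * ε ^ l = 1 := fun l => by rw [← mul_pow, hε, one_pow]
  rw [coeff_succ_recSeq_even hε, map_zero, zero_add, tSum_ones_odd, Finset.mul_sum, Finset.mul_sum]
  refine Finset.sum_congr rfl fun l _ => ?_
  rw [hodd]
  linear_combination (ε ^ (n + j + 1) * (2 * tSum (2 * j) (ones _) (l + 1) *
    (2 * l + 1 : ℝ)⁻¹)) * hpow l

lemma coeff_recSeq_odd_of_even (hε : ε * ε = 1) {j : ℕ}
    (heven : ∀ n, coeff (2 * j + 1) (recSeq ε 0 1 (2 * n)) =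
      ε ^ (n + j + 1) * tSum (2 * j + 1) (ones _) n) (n : ℕ) :
    coeff (2 * j + 2) (recSeq ε 0 1 (2 * n + 1)) =
      ε ^ (n + j + 1) * tSum (2 * j + 2) (ones _) (n + 1) := by
  have hpow : ∀ l, ε ^ l * ε ^ l = 1 := fun l => by rw [← mul_pow, hε, one_pow]
  rw [coeff_succ_recSeq_odd hε, coeff_one, if_neg (by omega), zero_add, tSum_ones_even,
    Finset.mul_sum, Finset.mul_sum]
  refine Finset.sum_congr rfl fun l _ => ?_
  rw [heven]
  linear_combination (ε ^ (n + j + 1) * (2 * tSum (2 * j + 1) (ones _) (l + 1) *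
    (2 * l + 2 : ℝ)⁻¹)) * hpow (l + 1)

lemma coeff_even_recSeq_odd_eq_tSum (hε : ε * ε = 1) (j n : ℕ) :
    coeff (2 * j) (recSeq ε 0 1 (2 * n + 1)) = ε ^ (n + j) * tSum (2 * j) (ones _) (n + 1) := by
  induction j generalizing n with
  | zero => rw [mul_zero, coeff_zero_recSeq_odd, coeff_zero_one, tSum, add_zero]
  | succ j ih => exact coeff_recSeq_odd_of_even hε (coeff_recSeq_even_of_odd hε ih) n

lemma coeff_odd_recSeq_even_eq_tSum (hε : ε * ε = 1) (j n : ℕ) :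
    coeff (2 * j + 1) (recSeq ε 0 1 (2 * n)) = ε ^ (n + j + 1) * tSum (2 * j + 1) (ones _) n :=
  coeff_recSeq_even_of_odd hε (coeff_even_recSeq_odd_eq_tSum hε j) n

lemma coeff_odd_recSeq_odd_eq_sSum_of_even {j : ℕ}
    (heven : ∀ n, coeff (2 * j) (recSeq 1 1 0 (2 * n)) = sSum (2 * j) (ones _) n) (n : ℕ) :
    coeff (2 * j + 1) (recSeq 1 1 0 (2 * n + 1)) = sSum (2 * j + 1) (ones _) (n + 1) := by
  simp only [coeff_succ_recSeq_odd (one_mul 1), heven, one_pow, one_mul, map_zero, zero_add,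
    sSum_ones_odd]

lemma coeff_even_recSeq_even_eq_sSum (j n : ℕ) :
    coeff (2 * j) (recSeq 1 1 0 (2 * n)) = sSum (2 * j) (ones _) n := by
  induction j generalizing n with
  | zero => rw [mul_zero, coeff_zero_recSeq_even, coeff_zero_one, one_pow, mul_one, sSum]
  | succ j ih =>
    change coeff (2 * j + 1 + 1) (recSeq 1 1 0 (2 * n)) = sSum (2 * j + 2) (ones _) n
    rw [coeff_succ_recSeq_even (one_mul 1), coeff_one, if_neg (by omega), zero_add, sSum_ones_even]
    simp only [coeff_odd_recSeq_odd_eq_sSum_of_even ih, one_pow, one_mul]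

lemma coeff_odd_recSeq_odd_eq_sSum (j n : ℕ) :
    coeff (2 * j + 1) (recSeq 1 1 0 (2 * n + 1)) = sSum (2 * j + 1) (ones _) (n + 1) :=
  coeff_odd_recSeq_odd_eq_sSum_of_even (coeff_even_recSeq_even_eq_sSum j) n

end ClosedForms

section CayleyCoefficients

open PowerSeries

lemma coeff_cayleyMoment (q k : ℕ) :
    coeff q (cayleyMoment k) = ∑ l ∈ Finset.range (q + 1),
      2 * zetaBar (q - l) * coeff l (recSeq 1 0 1 k) + coeff q (recSeq 1 1 0 k) := by
  rw [cayleyMoment, recSeq_eq, one_mul, add_comm, map_add, mul_comm (moments _), coeff_mul,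
    Finset.Nat.sum_antidiagonal_eq_sum_range_succ fun i l =>
      coeff i (recSeq 1 0 1 k) * coeff l (moments cayleyWeight)]
  simp only [coeff_moments_cayleyWeight, mul_comm]

lemma coeff_odd_cayleyMoment_even (p n : ℕ) :
    coeff (2 * p + 1) (cayleyMoment (2 * n)) = ∑ j ∈ Finset.range (p + 1),
      2 * zetaBar (2 * p - 2 * j) * tSum (2 * j + 1) (ones _) n := by
  rw [coeff_cayleyMoment, coeff_recSeq_one_zero_of_odd (by grind), add_zero,
    show 2 * p + 1 + 1 = 2 * (p + 1) by ring, sum_range_two_mul]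
  refine Finset.sum_congr rfl fun j _ => ?_
  rw [coeff_recSeq_zero_one_of_even (by grind), mul_zero, zero_add,
    coeff_odd_recSeq_even_eq_tSum (one_mul 1), one_pow, one_mul, Nat.add_sub_add_right]

lemma coeff_even_cayleyMoment_even (p n : ℕ) :
    coeff (2 * p) (cayleyMoment (2 * n)) = ∑ j ∈ Finset.range p,
      2 * zetaBar (2 * p - 1 - 2 * j) * tSum (2 * j + 1) (ones _) n + sSum (2 * p) (ones _) n := by
  rw [coeff_cayleyMoment, coeff_even_recSeq_even_eq_sSum, Finset.sum_range_succ, sum_range_two_mul,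
    coeff_recSeq_zero_one_of_even (by grind), mul_zero, add_zero]
  congr 1
  refine Finset.sum_congr rfl fun j _ => ?_
  rw [coeff_recSeq_zero_one_of_even (by grind), mul_zero, zero_add,
    coeff_odd_recSeq_even_eq_tSum (one_mul 1), one_pow, one_mul, Nat.sub_sub, add_comm 1]

lemma coeff_odd_cayleyMoment_odd (p : ℕ) {n : ℕ} (hn : 1 ≤ n) :
    coeff (2 * p + 1) (cayleyMoment (2 * n - 1)) = ∑ j ∈ Finset.range (p + 1),
      2 * zetaBar (2 * p + 1 - 2 * j) * tSum (2 * j) (ones _) n +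
        sSum (2 * p + 1) (ones _) n := by
  obtain ⟨n, rfl⟩ := Nat.exists_eq_add_of_le' hn
  rw [show 2 * (n + 1) - 1 = 2 * n + 1 by omega, coeff_cayleyMoment, coeff_odd_recSeq_odd_eq_sSum,
    show 2 * p + 1 + 1 = 2 * (p + 1) by ring, sum_range_two_mul]
  congr 1
  refine Finset.sum_congr rfl fun j _ => ?_
  rw [coeff_recSeq_zero_one_of_even (q := 2 * j + 1) (by grind), mul_zero, add_zero,
    coeff_even_recSeq_odd_eq_tSum (one_mul 1), one_pow, one_mul]

lemma coeff_even_cayleyMoment_odd (p : ℕ) {n : ℕ} (hn : 1 ≤ n) :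
    coeff (2 * p) (cayleyMoment (2 * n - 1)) = ∑ j ∈ Finset.range (p + 1),
      2 * zetaBar (2 * p - 2 * j) * tSum (2 * j) (ones _) n := by
  obtain ⟨n, rfl⟩ := Nat.exists_eq_add_of_le' hn
  rw [show 2 * (n + 1) - 1 = 2 * n + 1 by omega, coeff_cayleyMoment,
    coeff_recSeq_one_zero_of_odd (by grind), add_zero, Finset.sum_range_succ, sum_range_two_mul,
    Finset.sum_range_succ]
  congr 1
  · refine Finset.sum_congr rfl fun j _ => ?_
    rw [coeff_recSeq_zero_one_of_even (q := 2 * j + 1) (by grind), mul_zero, add_zero,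
      coeff_even_recSeq_odd_eq_tSum (one_mul 1), one_pow, one_mul]
  · rw [coeff_even_recSeq_odd_eq_tSum (one_mul 1), one_pow, one_mul]

end CayleyCoefficients

section Formulas

open PowerSeries

lemma hasSeries_W_even (m q : ℕ) :
    HasSeries (fun n => (-1) ^ (m + 1) *
      (tSum (2 * m + 1) (ones _) n * coeff q (cayleyMoment (2 * n)) / n * (-1) ^ n))
      (W (2 * m + 2 + q) (2 * m + 2)) := by
  have hvanish : ∀ k, Odd k →
      2 * arctanCoeff (2 * m + 1) k / k * coeff q (cayleyMoment k) = 0 := fun k hk => by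
    rw [arctanCoeff, coeff_recSeq_zero_one_of_even (by grind), mul_zero, zero_div, zero_mul]
  have h := (hasSeries_cayley_expansion (2 * m + 1) q).even hvanish
  have hsign : (-1 : ℝ) ^ (2 * m + 1 + 1) = 1 := Even.neg_one_pow ⟨m + 1, by ring⟩
  rw [W_eq_coeff_weightedAngleMoment (2 * m + 1), hsign, one_mul]
  refine h.congr fun n hn => ?_
  rw [arctanCoeff, coeff_odd_recSeq_even_eq_tSum (by norm_num)]
  push_cast
  field

lemma hasSeries_W_odd (m q : ℕ) :
    HasSeries (fun n => 2 * (-1) ^ m *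
      (tSum (2 * m) (ones _) n * coeff q (cayleyMoment (2 * n - 1)) / (2 * n - 1) * (-1) ^ n))
      (W (2 * m + 1 + q) (2 * m + 1)) := by
  have hvanish : ∀ k, Even k →
      2 * arctanCoeff (2 * m) k / k * coeff q (cayleyMoment k) = 0 := fun k hk => by
    rw [arctanCoeff, coeff_recSeq_zero_one_of_even (by grind), mul_zero, zero_div, zero_mul]
  have h := ((hasSeries_cayley_expansion (2 * m) q).odd hvanish).const_mul (-1)
  rw [W_eq_coeff_weightedAngleMoment (2 * m), (odd_two_mul_add_one m).neg_one_pow]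
  refine h.congr fun n hn => ?_
  obtain ⟨n, rfl⟩ := Nat.exists_eq_add_of_le' hn
  rw [show 2 * (n + 1) - 1 = 2 * n + 1 by omega, arctanCoeff,
    coeff_even_recSeq_odd_eq_tSum (by norm_num)]
  push_cast
  ring

theorem W_odd_weight_even_depth (m p : ℕ) :
    W (2 * m + 2 + (2 * p + 1)) (2 * m + 2) =
      2 * (-1) ^ (m + 1) * ∑ j ∈ Finset.range (p + 1),
        zetaBar (2 * p - 2 * j) * series (termTTEven (2 * m + 1) (2 * j + 1)) := by
  rw [Finset.mul_sum]
  refine (hasSeries_W_even m (2 * p + 1)).unique ((HasSeries.sum fun j _ =>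
    ((termTTEven_converges (2 * m + 1) (2 * j + 1)).hasSeries.const_mul
      (zetaBar (2 * p - 2 * j))).const_mul (2 * (-1) ^ (m + 1))).congr fun n _ => ?_)
  simp only [coeff_odd_cayleyMoment_even, termTTEven, Finset.mul_sum, Finset.sum_mul,
    Finset.sum_div]
  exact Finset.sum_congr rfl fun j _ => by ring

theorem W_even_weight_even_depth (m p : ℕ) :
    W (2 * m + 2 + 2 * p) (2 * m + 2) =
      2 * (-1) ^ (m + 1) * ∑ j ∈ Finset.range p,
          zetaBar (2 * p - 1 - 2 * j) * series (termTTEven (2 * m + 1) (2 * j + 1)) +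
        (-1) ^ (m + 1) * series (termTSEven (2 * m + 1) (2 * p)) := by
  rw [Finset.mul_sum]
  refine (hasSeries_W_even m (2 * p)).unique (((HasSeries.sum fun j _ =>
    ((termTTEven_converges (2 * m + 1) (2 * j + 1)).hasSeries.const_mul
      (zetaBar (2 * p - 1 - 2 * j))).const_mul (2 * (-1) ^ (m + 1))).add
    ((termTSEven_converges (2 * m + 1) (2 * p)).hasSeries.const_mul
      ((-1) ^ (m + 1)))).congr fun n _ => ?_)
  simp only [coeff_even_cayleyMoment_even, termTTEven, termTSEven, mul_add, add_mul, add_div,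
    Finset.mul_sum, Finset.sum_mul, Finset.sum_div]
  congr 1
  exact Finset.sum_congr rfl fun j _ => by ring

theorem W_even_weight_odd_depth (m p : ℕ) :
    W (2 * m + 1 + (2 * p + 1)) (2 * m + 1) =
      4 * (-1) ^ m * ∑ j ∈ Finset.range (p + 1),
          zetaBar (2 * p + 1 - 2 * j) * series (termTTOdd (2 * m) (2 * j)) +
        2 * (-1) ^ m * series (termTSOdd (2 * m) (2 * p + 1)) := by
  rw [Finset.mul_sum]
  refine (hasSeries_W_odd m (2 * p + 1)).unique (((HasSeries.sum fun j _ =>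
    ((termTTOdd_converges (2 * m) (2 * j)).hasSeries.const_mul
      (zetaBar (2 * p + 1 - 2 * j))).const_mul (4 * (-1) ^ m)).add
    ((termTSOdd_converges (2 * m) (2 * p + 1)).hasSeries.const_mul
      (2 * (-1) ^ m))).congr fun n hn => ?_)
  simp only [coeff_odd_cayleyMoment_odd p hn, termTTOdd,
    termTSOdd, mul_add, add_mul, add_div, Finset.mul_sum, Finset.sum_mul, Finset.sum_div]
  congr 1
  exact Finset.sum_congr rfl fun j _ => by ring

theorem W_odd_weight_odd_depth (m p : ℕ) :
    W (2 * m + 1 + 2 * p) (2 * m + 1) =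
      4 * (-1) ^ m * ∑ j ∈ Finset.range (p + 1),
        zetaBar (2 * p - 2 * j) * series (termTTOdd (2 * m) (2 * j)) := by
  rw [Finset.mul_sum]
  refine (hasSeries_W_odd m (2 * p)).unique ((HasSeries.sum fun j _ =>
    ((termTTOdd_converges (2 * m) (2 * j)).hasSeries.const_mul
      (zetaBar (2 * p - 2 * j))).const_mul (4 * (-1) ^ m)).congr fun n hn => ?_)
  simp only [coeff_even_cayleyMoment_odd p hn, termTTOdd, Finset.mul_sum,
    Finset.sum_mul, Finset.sum_div]
  exact Finset.sum_congr rfl fun j _ => by ring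

lemma altTTerm_converges_of_mem {w r : ℕ} {k : Fin r → ℕ} (hr : 1 ≤ r) (hk : k ∈ indexSet w r) :
    SeriesConverges (altTTerm r k) := by
  obtain ⟨r, rfl⟩ := Nat.exists_eq_add_of_le' hr
  exact altTTerm_converges (mem_indexSet.1 hk).2

end Formulas

end AltMTV

end

theorem theorem2p3 (m p : ℕ) (hm : 1 ≤ m) (hp : 1 ≤ p) :
    -- all the series that occur converge
    ((∀ s : ℕ, 1 ≤ s → SeriesConverges (zetaBarTerm s)) ∧
      (∀ k ∈ indexSet (2 * p + 2 * m - 1) (2 * m), SeriesConverges (altTTerm (2 * m) k)) ∧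
      (∀ k ∈ indexSet (2 * p + 2 * m - 2) (2 * m), SeriesConverges (altTTerm (2 * m) k)) ∧
      (∀ k ∈ indexSet (2 * p + 2 * m - 2) (2 * m - 1),
        SeriesConverges (altTTerm (2 * m - 1) k)) ∧
      (∀ k ∈ indexSet (2 * p + 2 * m - 3) (2 * m - 1),
        SeriesConverges (altTTerm (2 * m - 1) k)) ∧
      (∀ j < p, SeriesConverges (termTTEven (2 * m - 1) (2 * j + 1))) ∧
      SeriesConverges (termTSEven (2 * m - 1) (2 * p - 2)) ∧
      (∀ j < p, SeriesConverges (termTTOdd (2 * m - 2) (2 * j))) ∧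
      SeriesConverges (termTSOdd (2 * m - 2) (2 * p - 1))) ∧
    -- the four formulas
    W (2 * p + 2 * m - 1) (2 * m) =
      2 * (-1) ^ m * ∑ j ∈ Finset.range p,
        zetaBar (2 * p - 2 - 2 * j) * series (termTTEven (2 * m - 1) (2 * j + 1)) ∧
    W (2 * p + 2 * m - 2) (2 * m) =
      2 * (-1) ^ m * ∑ j ∈ Finset.range (p - 1),
          zetaBar (2 * p - 3 - 2 * j) * series (termTTEven (2 * m - 1) (2 * j + 1)) +
        (-1) ^ m * series (termTSEven (2 * m - 1) (2 * p - 2)) ∧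
    W (2 * p + 2 * m - 2) (2 * m - 1) =
      4 * (-1) ^ (m - 1) * ∑ j ∈ Finset.range p,
          zetaBar (2 * p - 1 - 2 * j) * series (termTTOdd (2 * m - 2) (2 * j)) +
        2 * (-1) ^ (m - 1) * series (termTSOdd (2 * m - 2) (2 * p - 1)) ∧
    W (2 * p + 2 * m - 3) (2 * m - 1) =
      4 * (-1) ^ (m - 1) * ∑ j ∈ Finset.range p,
        zetaBar (2 * p - 2 - 2 * j) * series (termTTOdd (2 * m - 2) (2 * j)) := by
  obtain ⟨m, rfl⟩ := Nat.exists_eq_add_of_le' hm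
  obtain ⟨p, rfl⟩ := Nat.exists_eq_add_of_le' hp
  refine ⟨⟨fun s => zetaBarTerm_converges, fun k => altTTerm_converges_of_mem (by omega),
    fun k => altTTerm_converges_of_mem (by omega), fun k => altTTerm_converges_of_mem (by omega),
    fun k => altTTerm_converges_of_mem (by omega), fun j _ => termTTEven_converges _ _,
    termTSEven_converges _ _, fun j _ => termTTOdd_converges _ _, termTSOdd_converges _ _⟩,
    ?_, ?_, ?_, ?_⟩
  · rw [show 2 * (p + 1) + 2 * (m + 1) - 1 = 2 * m + 2 + (2 * p + 1) by omega]
    exact W_odd_weight_even_depth m p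
  · rw [show 2 * (p + 1) + 2 * (m + 1) - 2 = 2 * m + 2 + 2 * p by omega]
    exact W_even_weight_even_depth m p
  · rw [show 2 * (p + 1) + 2 * (m + 1) - 2 = 2 * m + 1 + (2 * p + 1) by omega]
    exact W_even_weight_odd_depth m p
  · rw [show 2 * (p + 1) + 2 * (m + 1) - 3 = 2 * m + 1 + 2 * p by omega]
    exact W_odd_weight_odd_depth m p
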